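/- Let $p$ be a prime and $n\ge 1$. Let $K$ be a local field of characteristic $p$ (a field complete with respect to a normalized discrete valuation $v_K$, with perfect residue field), and let $L/K$ be a totally ramified Galois extension with $\mathrm{Gal}(L/K)\cong C_{p^n}$; let $v_L$ be the normalized valuation of $L$. Let $b_1<\cdots<b_n$ and $u_1<\cdots<u_n$ be the lower and upper ramification breaks of $L/K$. Write $\phi(x)=x^p$, acting coordinatewise on vectors, and let $\oplus$ be addition in the ring $W_n$ of Witt vectors of length $n$. Let $\vec\beta=(\beta_0,\dots,\beta_{n-1})\in W_n(K)$ be a Witt vector that corresponds to $L/K$ under Artin–Schreier–Witt theory, i.e. there is $\vec x=(x_0,\dots,x_{n-1})\in W_n(L)$ with $\phi(\vec x)=\vec x\oplus\vec\beta$ and $L=K(x_0,\dots,x_{n-1})$; fix such an $\vec x$. Suppose that $\vec\beta$ is reduced: for each $0\le i\le n-1$, either $v_K(\beta_i)\ge 0$ or $p\nmid v_K(\beta_i)$. Put $\beta=\beta_0$ and suppose that there are $\omega_i,\delta_i\in K$ $(0\le i\le n-1)$ with $\omega_0=1$, $\delta_0=0$, $$\beta_i=\beta\,\omega_i^{p^{n-1}}+\delta_i,\qquad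 v_K(\delta_i)>v_K(\beta_i)\qquad(0\le i\le n-1),$$ and that for $1\le i\le n-1$ $$b_{i+1}>p^n u_i,\qquad b_{i+1}>-p^{n-1}v_K(\delta_i).$$ Let $\vec\omega=(\omega_0,\dots,\omega_{n-1})$, let $m_i=-v_K(\omega_i)$, and let $$\mathbf Y=\det[\vec x,\vec\omega,\phi(\vec\omega),\dots,\phi^{n-2}(\vec\omega)]\in L$$ be the determinant of the $n\times n$ matrix with these columns (so $\mathbf Y=x_0$ if $n=1$). Then $L=K(\mathbf Y)$ and $$v_L(\mathbf Y)=-b_1-p^n m_1-p^{n+1}m_2-\cdots-p^{2n-2}m_{n-1}=-b_1-\sum_{i=1}^{n-1}p^{\,n-1+i}m_i .$$ -/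

import Mathlib

open scoped WithZero

noncomputable section

namespace ASW

/-- The additive value attached to a normalized discrete valuation, so that
`v x = exp (-ord v x)` for `x ≠ 0` (and the junk value `0` at `x = 0`). In particular,
`v x < v y` says that the additive value of `x` is larger than that of `y`. -/
def ord {F : Type*} [Field F] (v : Valuation F ℤᵐ⁰) (x : F) : ℤ :=
  -WithZero.log (v x)

/-- Given a normalized valuation `v` of `K` and a normalized valuation `w` of `L`,
the extension `L / K` is totally ramified if `w` extends `v` with ramification index `[L : K]`. -/
def IsTotallyRamified (K L : Type*) [Field K] [Field L] [Algebra K L]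
    (v : Valuation K ℤᵐ⁰) (w : Valuation L ℤᵐ⁰) : Prop :=
  ∀ a : K, w (algebraMap K L a) = v a ^ Module.finrank K L

section Ramification

variable (K : Type*) {L : Type*} [Field K] [Field L] [Algebra K L] [FiniteDimensional K L]
  (w : Valuation L ℤᵐ⁰)

/-- The `j`-th ramification group in the lower numbering: the automorphisms `σ` with
`σ x ≡ x` modulo the `(j+1)`-st power of the maximal ideal, for all `x` in the ring of integers. -/
def lowerRamificationGroup (j : ℕ) : Subgroup (L ≃ₐ[K] L) :=
  let M : Submonoid (L ≃ₐ[K] L) :=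
    { carrier := {σ | ∀ x : L, w x ≤ 1 → w (σ x - x) ≤ WithZero.exp (-((j : ℤ) + 1))}
      one_mem' := by
        intro x _
        simp
      mul_mem' := by
        intro σ τ hσ hτ x hx
        have h1 := hτ x hx
        have hlt : WithZero.exp (-((j : ℤ) + 1)) ≤ (1 : ℤᵐ⁰) := by
          rw [← WithZero.exp_zero, WithZero.exp_le_exp]
          omega
        have h2 : w (τ x) ≤ 1 := by
          have h := w.map_add_le (h1.trans hlt) hx
          simpa using h
        have h := w.map_add_le (hσ (τ x) h2) h1
        simpa using h }
  { M with
    inv_mem' := by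
      intro σ hσ
      have hfin : IsOfFinOrder σ := isOfFinOrder_of_finite σ
      have hpow : σ⁻¹ = σ ^ (orderOf σ - 1) := by
        rw [inv_eq_iff_mul_eq_one, ← pow_succ',
          Nat.sub_add_cancel hfin.orderOf_pos, pow_orderOf_eq_one]
      have h : σ⁻¹ ∈ M := by
        rw [hpow]
        exact M.pow_mem hσ _
      exact h }

/-- `j` is a lower ramification break: the ramification groups number `j` and `j + 1` differ. -/
def IsLowerBreak (j : ℕ) : Prop :=
  lowerRamificationGroup K w (j + 1) ≠ lowerRamificationGroup K w j

/-- The `i`-th lower ramification break `b_i` in increasing order, numbered from `i = 1`. -/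
def lowerBreak (i : ℕ) : ℕ :=
  Nat.nth (IsLowerBreak K w) (i - 1)

/-- The Hasse–Herbrand function at natural numbers,
`φ(m) = ∫_0^m dt / [G_0 : G_t] = (|G_1| + ⋯ + |G_m|) / |G_0|`. -/
def herbrand (m : ℕ) : ℚ :=
  (∑ j ∈ Finset.Icc 1 m, (Nat.card (lowerRamificationGroup K w j) : ℚ)) /
    (Nat.card (lowerRamificationGroup K w 0) : ℚ)

/-- The `i`-th upper ramification break `u_i = φ(b_i)`, numbered from `i = 1`. -/
def upperBreak (i : ℕ) : ℚ :=
  herbrand K w (lowerBreak K w i)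

end Ramification

/-- The map on Witt vectors of length `n` that applies `f` to every coordinate. -/
def wittMap {p n : ℕ} {R S : Type*} (f : R → S) (x : TruncatedWittVector p n R) :
    TruncatedWittVector p n S :=
  TruncatedWittVector.mk p fun i => f (x.coeff i)

/-- A Witt vector over `K` is reduced if each coordinate is integral or has a valuation
prime to `p`. -/
def IsReducedWitt {p n : ℕ} {K : Type*} [Field K] (v : Valuation K ℤᵐ⁰)
    (β : TruncatedWittVector p n K) : Prop :=
  ∀ i, v (β.coeff i) ≤ 1 ∨ ¬ (p : ℤ) ∣ ord v (β.coeff i)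

/-- The element `x` of `W_n(L)` solves `φ(x) = x ⊕ β` and its coordinates generate `L / K`,
i.e. `β` corresponds to `L / K` under Artin–Schreier–Witt theory, with solution `x`. -/
def IsSolution {p n : ℕ} [Fact p.Prime] {K L : Type*} [Field K] [Field L] [Algebra K L]
    (β : TruncatedWittVector p n K) (x : TruncatedWittVector p n L) : Prop :=
  wittMap (fun a => a ^ p) x = x + wittMap (algebraMap K L) β ∧
    IntermediateField.adjoin K (Set.range fun i => x.coeff i) = ⊤

/-- The `n × n` matrix with columns `x, ω, φ(ω), …, φ^{n-2}(ω)`. -/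
def matrixY (p : ℕ) {n : ℕ} {K L : Type*} [Field K] [Field L] [Algebra K L]
    (ω : Fin n → K) (x : TruncatedWittVector p n L) : Matrix (Fin n) (Fin n) L :=
  Matrix.of fun i j =>
    if (j : ℕ) = 0 then x.coeff i else algebraMap K L (ω i) ^ p ^ ((j : ℕ) - 1)

/-- The element `Y = det [x, ω, φ(ω), …, φ^{n-2}(ω)]`. -/
def elementY (p : ℕ) {n : ℕ} {K L : Type*} [Field K] [Field L] [Algebra K L]
    (ω : Fin n → K) (x : TruncatedWittVector p n L) : L :=
  (matrixY p ω x).det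

end ASW

end

open ASW

/-!
Write `φ` for the `p`-th power map and call `k` the pole order of an element `z` with
`w z = exp k`, so that pole orders are negatives of additive valuations; the lemmas below are
phrased in terms of them.

Raising the determinant `Y = det [x, ω, φ(ω), …, φ^(n-2)(ω)]` to the power `p ^ n` replaces `x` by
`φ^n(x)` and `φ^k(ω)` by `φ^(n+k)(ω)`. Iterating `φ(x) = x ⊕ β` gives
`φ^n(x) = x + ∑ φ^k(β + D)`, where `D` collects the cross terms of Witt vector addition, and
`φ^k(β)` is, up to the error `φ^k(δ)`, a multiple of `φ^(n-1+k)(ω)`. For `k ≥ 1` this is a multiple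
of another column. What remains is `β₀ det [φ^(n-1)(ω), …, φ^(2n-2)(ω)]` plus the contribution of
the row errors `x + ∑ φ^k(δ + D)` (`detCol_pow_eq`). The valuation of the first determinant is that
of its diagonal, by the rearrangement inequality (`valuation_det_powers`). The `i`-th row error
does not matter as long as its pole order is less than `p ^ n` times the number
`lowerOfUpper p B i`, which is the lower break corresponding to the upper breaks `B j`, the pole
orders of the coordinates of `β` (`valuation_detCol_pow`). The cross terms are bounded since
Witt vector addition is isobaric (`valuation_cross_term_le`).

The hypotheses concern the ramification breaks of `L / K`, so these have to be related to the pole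
orders `B i`. Let `σ` generate the Galois group. The `i`-th lower break `b i` (counted from `0`) is
the depth of `τ = σ ^ (p ^ i)` in the ramification filtration, and can be read off from any
element `z` of the fixed field `M` of `σ ^ (p ^ (i + 1))` whose normalized valuation on `M` is
prime to `p`: one has `w (τ z - z) = w z * exp (-(q * b i))` with `q = [L : M]`. This rests on two
facts. Every element of `M` has an expansion in powers of a uniformizer of `M` with coefficients
in `K`, whose terms have distinct valuations because the extension is totally ramified
(`exists_expansion`, `valuation_map_sub_le`). And the norm to `M` of a uniformizer `ϖ` of `L` is so
close to `ϖ ^ q`, as the next break is large, that `τ` has the same depth on `M` as on `L`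
(`exists_uniformizer_fixedField`).

Now `τ` fixes the coordinates `x_j` with `j < i`, and `τ x_i - x_i` is a nonzero constant of the
prime field (`exists_galois_action`). By induction on `i`, first `z = x_i` shows that `B i` is more
than `p` times the previous pole order; then `z = Y_i / t`, where `Y_i` is the analogue of `Y` for
the first `i + 1` rows and `t` the minor belonging to `x_i`, again is moved by `τ` by a nonzero
constant only and shows that `b i = lowerOfUpper p B i` (`depth_eq_lowerOfUpper`, `rowBounds`). With
all row errors under control, the valuation of `Y` follows. It is prime to `p`, hence the powers of
`Y` with exponents below `p ^ n` have distinct valuations modulo `p ^ n` and are linearly independent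
over `K`, so `Y` generates `L` (`adjoin_eq_top_of_not_dvd`).
-/

open scoped WithZero

namespace ASW

/-! ### Addition of Witt vectors -/

section Witt

open WittVector

lemma coeff_init {p : ℕ} {R : Type*} [CommRing R] (x : WittVector p R) (i k : ℕ) :
    (init i x).coeff k = if k < i then x.coeff k else 0 := by
  simp only [init, select]
  split_ifs <;> simp [*]

lemma coeff_tail {p : ℕ} {R : Type*} [CommRing R] (x : WittVector p R) (i k : ℕ) :
    (tail i x).coeff k = if i ≤ k then x.coeff k else 0 := by
  simp only [tail, select]
  split_ifs <;> simp [*]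

variable {p : ℕ} [hp : Fact p.Prime] {R : Type*} [CommRing R]

/-- The first coordinate and the remaining ones of a Witt vector, separated. -/
lemma eq_teichmuller_add_verschiebung (x : WittVector p R) :
    x = teichmuller p (x.coeff 0) + verschiebung (x.shift 1) := by
  ext k
  rw [coeff_add_of_disjoint]
  · cases k with
    | zero => simp [teichmuller_coeff_zero]
    | succ k =>
      rw [teichmuller_coeff_pos _ _ _ (Nat.succ_pos k), verschiebung_coeff_succ, shift_coeff,
        zero_add, add_comm]
  · intro k
    cases k with
    | zero => right; simp
    | succ k => left; exact teichmuller_coeff_pos _ _ _ (Nat.succ_pos k)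

lemma frobenius_teichmuller [CharP R p] (a : R) :
    frobenius (teichmuller p a) = teichmuller p (a ^ p) := by
  ext k
  rw [coeff_frobenius_charP]
  cases k with
  | zero => rw [teichmuller_coeff_zero, teichmuller_coeff_zero]
  | succ k =>
    rw [teichmuller_coeff_pos _ _ _ (Nat.succ_pos k), teichmuller_coeff_pos _ _ _ (Nat.succ_pos k),
      zero_pow hp.out.ne_zero]

/-- Multiplication by a Teichmüller representative scales the `k`-th coordinate with weight
`p ^ k`. -/
lemma teichmuller_mul_coeff [CharP R p] (a : R) (x : WittVector p R) (k : ℕ) :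
    (teichmuller p a * x).coeff k = a ^ p ^ k * x.coeff k := by
  induction k generalizing a x with
  | zero => simp [mul_coeff_zero, teichmuller_coeff_zero]
  | succ k ih =>
    have h : teichmuller p a * x =
        teichmuller p (a * x.coeff 0) + verschiebung (x.shift 1 * teichmuller p (a ^ p)) := by
      conv_lhs => rw [eq_teichmuller_add_verschiebung x]
      rw [mul_add, ← map_mul, ← frobenius_teichmuller, verschiebung_mul_frobenius,
        mul_comm (verschiebung _)]
    rw [h, coeff_add_of_disjoint]
    · rw [teichmuller_coeff_pos _ _ _ (Nat.succ_pos k), verschiebung_coeff_succ,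
        mul_comm (shift _ _), ih, shift_coeff, zero_add, ← pow_mul, ← pow_succ', add_comm 1 k]
    · intro j
      cases j with
      | zero => right; simp
      | succ j => left; exact teichmuller_coeff_pos _ _ _ (Nat.succ_pos j)

/-- Adding a Witt vector of the form `V ^ i t` affects the `i`-th coordinate additively and leaves
the earlier ones unchanged. -/
lemma coeff_add_of_coeff_eq_zero (x y : WittVector p R) (i : ℕ) (hy : ∀ j < i, y.coeff j = 0) :
    (∀ j < i, (x + y).coeff j = x.coeff j) ∧ (x + y).coeff i = x.coeff i + y.coeff i := by
  obtain ⟨s, hs⟩ : ∃ s, tail i x = verschiebung^[i] s :=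
    ⟨x.shift i, by
      ext k
      rcases lt_or_ge k i with hk | hk
      · rw [iterate_verschiebung_coeff_eq_zero _ hk]; simp [coeff_tail, not_le.2 hk]
      · obtain ⟨m, rfl⟩ := Nat.exists_eq_add_of_le hk
        rw [add_comm i m, iterate_verschiebung_coeff, shift_coeff]
        simp [coeff_tail, add_comm]⟩
  obtain ⟨t, ht⟩ : ∃ t, y = verschiebung^[i] t :=
    ⟨y.shift i, (by
      ext k
      rcases lt_or_ge k i with hk | hk
      · rw [iterate_verschiebung_coeff_eq_zero _ hk, hy k hk]
      · obtain ⟨m, rfl⟩ := Nat.exists_eq_add_of_le hk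
        rw [add_comm i m, iterate_verschiebung_coeff, shift_coeff, add_comm])⟩
  have key : x + y = init i x + verschiebung^[i] (s + t) := by
    conv_lhs => rw [← init_add_tail x i, hs, ht]
    rw [iterate_map_add, add_assoc]
  have hdis : ∀ k, (init i x).coeff k = 0 ∨ (verschiebung^[i] (s + t)).coeff k = 0 := by
    intro k
    rcases lt_or_ge k i with hk | hk
    · right; exact iterate_verschiebung_coeff_eq_zero _ hk
    · left; simp [coeff_init, not_lt.2 hk]
  have hsi : s.coeff 0 = x.coeff i := by
    have := congrArg (fun z => z.coeff (0 + i)) hs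
    simp only [iterate_verschiebung_coeff] at this
    simpa [coeff_tail] using this.symm
  have hti : t.coeff 0 = y.coeff i := by
    have := congrArg (fun z => z.coeff (0 + i)) ht
    simp only [iterate_verschiebung_coeff] at this
    simpa using this.symm
  constructor
  · intro j hj
    rw [key, coeff_add_of_disjoint _ _ _ hdis, iterate_verschiebung_coeff_eq_zero _ hj]
    simp [coeff_init, hj]
  · rw [key, coeff_add_of_disjoint _ _ _ hdis]
    have := iterate_verschiebung_coeff (s + t) i 0
    rw [zero_add] at this
    rw [this, add_coeff_zero, hsi, hti]
    simp [coeff_init]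

/-- The cross term of the sum at coordinate `i` depends only on the coordinates before `i`. -/
lemma add_coeff_eq_init (x y : WittVector p R) (i : ℕ) :
    (x + y).coeff i = x.coeff i + y.coeff i + (init i x + init i y).coeff i := by
  have key : x + y = init i x + init i y + tail i x + tail i y := by
    conv_lhs => rw [← init_add_tail x i, ← init_add_tail y i]
    ring
  have hz : ∀ z : WittVector p R, ∀ j < i, (tail i z).coeff j = 0 := by
    intro z j hj
    simp [coeff_tail, not_le.2 hj]
  rw [key, (coeff_add_of_coeff_eq_zero _ _ i (hz y)).2, (coeff_add_of_coeff_eq_zero _ _ i (hz x)).2]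
  simp [coeff_tail]
  ring

/-- The polynomial `S_i - X_i - Y_i`, where `S_i` describes the `i`-th coordinate of a sum of Witt
vectors, is isobaric of weight `p ^ i` in the earlier coordinates, those with index `j` having
weight `p ^ j`. In terms of a valuation: if scaling by `a` makes the coordinates before the `i`-th
integral, it makes the cross term integral, too. -/
lemma valuation_cross_term_le {L : Type*} [Field L] [CharP L p] (w : Valuation L ℤᵐ⁰)
    (x y : WittVector p L) (i : ℕ) (a : L) (hx : ∀ j < i, w a ^ p ^ j * w (x.coeff j) ≤ 1)
    (hy : ∀ j < i, w a ^ p ^ j * w (y.coeff j) ≤ 1) :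
    w a ^ p ^ i * w ((x + y).coeff i - x.coeff i - y.coeff i) ≤ 1 := by
  have h : (x + y).coeff i - x.coeff i - y.coeff i = (init i x + init i y).coeff i := by
    rw [add_coeff_eq_init x y i]; ring
  have hlift : ∀ z : WittVector p L, (∀ j < i, w a ^ p ^ j * w (z.coeff j) ≤ 1) →
      ∃ Z : WittVector p w.integer, map (w.integer.subtype) Z = teichmuller p a * init i z := by
    intro z hz
    have hint : ∀ k, (teichmuller p a * init i z).coeff k ∈ w.integer := by
      intro k
      rw [Valuation.mem_integer_iff, teichmuller_mul_coeff, map_mul, map_pow]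
      rcases lt_or_ge k i with hk | hk
      · have : (init i z).coeff k = z.coeff k := by simp [coeff_init, hk]
        rw [this]
        exact hz k hk
      · have : (init i z).coeff k = 0 := by simp [coeff_init, not_lt.2 hk]
        simp [this]
    refine ⟨WittVector.mk p fun k => ⟨_, hint k⟩, ?_⟩
    ext k
    simp [map_coeff]
  obtain ⟨X, hX⟩ := hlift x hx
  obtain ⟨Y, hY⟩ := hlift y hy
  have hXY : map (w.integer.subtype) (X + Y) = teichmuller p a * (init i x + init i y) := by
    rw [map_add, hX, hY, mul_add]
  have := congrArg (fun z => z.coeff i) hXY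
  simp only [map_coeff, teichmuller_mul_coeff] at this
  rw [h, ← map_pow, ← map_mul, ← this]
  exact ((X + Y).coeff i).2

end Witt

/-! ### Truncated Witt vectors and the Galois action -/

section Truncated

lemma coeff_wittMap {p n : ℕ} {R S : Type*} (f : R → S) (x : TruncatedWittVector p n R)
    (i : Fin n) : (wittMap f x).coeff i = f (x.coeff i) := by
  simp [wittMap]

variable {p n : ℕ} [hp : Fact p.Prime]

lemma wittMap_truncate {R S : Type*} [CommRing R] [CommRing S] (f : R →+* S)
    (X : WittVector p R) :
    wittMap f (WittVector.truncate n X) = WittVector.truncate n (WittVector.map f X) := by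
  ext i
  simp [wittMap, WittVector.coeff_truncate, WittVector.map_coeff]

lemma wittMap_add {R S : Type*} [CommRing R] [CommRing S] (f : R →+* S)
    (x y : TruncatedWittVector p n R) : wittMap f (x + y) = wittMap f x + wittMap f y := by
  obtain ⟨X, rfl⟩ := WittVector.truncate_surjective p n R x
  obtain ⟨Y, rfl⟩ := WittVector.truncate_surjective p n R y
  simp only [← map_add, wittMap_truncate]

lemma wittMap_sub {R S : Type*} [CommRing R] [CommRing S] (f : R →+* S)
    (x y : TruncatedWittVector p n R) : wittMap f (x - y) = wittMap f x - wittMap f y := by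
  obtain ⟨X, rfl⟩ := WittVector.truncate_surjective p n R x
  obtain ⟨Y, rfl⟩ := WittVector.truncate_surjective p n R y
  simp only [← map_sub, wittMap_truncate]

/-- Truncated Witt vectors are added by extending them by zero. -/
lemma truncated_coeff_add {R : Type*} [CommRing R] (x y : TruncatedWittVector p n R) (i : Fin n) :
    (x + y).coeff i = (x.out + y.out).coeff i := by
  conv_lhs => rw [← TruncatedWittVector.truncateFun_out x, ← TruncatedWittVector.truncateFun_out y,
    ← WittVector.truncateFun_add]
  rw [WittVector.coeff_truncateFun]

/-- In characteristic `p`, multiplication by `p` shifts the coordinates and raises them to the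
`p`-th power. -/
lemma truncated_coeff_pow_nsmul {R : Type*} [CommRing R] [CharP R p]
    (x : TruncatedWittVector p n R) (i : ℕ) :
    (∀ j : Fin n, (j : ℕ) < i → (p ^ i • x).coeff j = 0) ∧
      ∀ (k j : Fin n), (j : ℕ) = i + k → (p ^ i • x).coeff j = x.coeff k ^ p ^ i := by
  obtain ⟨X, rfl⟩ := WittVector.truncate_surjective p n R x
  have h : p ^ i • X = X * (p : WittVector p R) ^ i := by
    rw [nsmul_eq_mul, mul_comm]; push_cast; rfl
  rw [← map_nsmul, h]
  constructor
  · intro j hj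
    rw [WittVector.coeff_truncate, WittVector.mul_pow_charP_coeff_zero _ hj]
  · intro k j hj
    rw [WittVector.coeff_truncate, WittVector.coeff_truncate, hj, add_comm,
      WittVector.mul_pow_charP_coeff_succ]

end Truncated

section GaloisAction

variable {p n : ℕ} [hp : Fact p.Prime] {K L : Type*} [Field K] [Field L] [Algebra K L]

lemma map_eq_self_of_pow_eq_self [CharP L p] (σ : L ≃ₐ[K] L) {a : L} (ha : a ^ p = a) :
    σ a = a := by
  have h : a ∈ (⊥ : Subfield L) := (Subfield.mem_bot_iff_pow_eq_self L p).2 ha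
  have h2 : (⊥ : Subfield L) ≤ RingHom.eqLocusField (σ : L →+* L) (RingHom.id L) := bot_le
  exact h2 h

lemma valuation_eq_one_of_pow_eq_self (w : Valuation L ℤᵐ⁰) {a : L} (ha : a ^ p = a)
    (ha0 : a ≠ 0) : w a = 1 := by
  have hw0 : w a ≠ 0 := (Valuation.ne_zero_iff w).2 ha0
  have h : w a ^ p = w a := by rw [← map_pow, ha]
  have hp1 := hp.out.one_lt
  have h1 : w a ^ (p - 1) = 1 := by
    have : w a ^ (p - 1) * w a = 1 * w a := by
      rw [← pow_succ, Nat.sub_add_cancel hp1.le, h, one_mul]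
    exact mul_right_cancel₀ hw0 this
  exact (pow_eq_one_iff_of_nonneg zero_le (by omega)).1 h1

/-- The difference `σ x - x` has coordinates in the prime field. -/
lemma frobenius_wittMap_sub [CharP L p] {β : TruncatedWittVector p n K}
    {x : TruncatedWittVector p n L}
    (hx : wittMap (fun a => a ^ p) x = x + wittMap (algebraMap K L) β) (σ : L ≃ₐ[K] L)
    (j : Fin n) :
    (wittMap σ x - x).coeff j ^ p = (wittMap σ x - x).coeff j := by
  have hF : ∀ z : TruncatedWittVector p n L,
      wittMap (fun a => a ^ p) z = wittMap (frobenius L p) z := fun z => rfl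
  have hσ : ∀ z : TruncatedWittVector p n L, wittMap σ z = wittMap (σ : L →+* L) z := fun z => rfl
  have hβ : wittMap (σ : L →+* L) (wittMap (algebraMap K L) β) = wittMap (algebraMap K L) β := by
    ext i
    simp [coeff_wittMap]
  have hcomm : wittMap (frobenius L p) (wittMap (σ : L →+* L) x) =
      wittMap (σ : L →+* L) (wittMap (frobenius L p) x) := by
    ext i
    simp [coeff_wittMap, frobenius_def]
  have key : wittMap (frobenius L p) (wittMap σ x - x) = wittMap σ x - x := by
    rw [hσ, wittMap_sub, hcomm, ← hF, hx, wittMap_add, hβ]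
    abel
  have := congrArg (fun z => z.coeff j) key
  simpa [coeff_wittMap, frobenius_def] using this

lemma wittMap_pow_eq [CharP L p] {β : TruncatedWittVector p n K}
    {x : TruncatedWittVector p n L}
    (hx : wittMap (fun a => a ^ p) x = x + wittMap (algebraMap K L) β) (σ : L ≃ₐ[K] L) (k : ℕ) :
    wittMap (σ ^ k : L ≃ₐ[K] L) x = x + k • (wittMap σ x - x) := by
  induction k with
  | zero => ext i; simp [coeff_wittMap]
  | succ k ih =>
    have h1 : wittMap (σ ^ (k + 1) : L ≃ₐ[K] L) x =
        wittMap ((σ ^ k : L ≃ₐ[K] L) : L →+* L) (x + (wittMap σ x - x)) := by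
      ext i
      simp [coeff_wittMap, pow_succ]
    have h2 : wittMap ((σ ^ k : L ≃ₐ[K] L) : L →+* L) (wittMap σ x - x) = wittMap σ x - x := by
      ext i
      rw [coeff_wittMap]
      exact map_eq_self_of_pow_eq_self (p := p) _ (frobenius_wittMap_sub hx σ i)
    have h3 : wittMap ((σ ^ k : L ≃ₐ[K] L) : L →+* L) x = wittMap (σ ^ k : L ≃ₐ[K] L) x := rfl
    rw [h1, wittMap_add, h2, h3, ih, succ_nsmul, add_assoc]

/-- The generator `σ` acts on a solution by `x ↦ x ⊕ c` for a vector `c` over the prime field,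
so `σ ^ (p ^ i)` acts by adding `p ^ i c`, whose first non-vanishing coordinate has index `i`. -/
lemma exists_galois_action [CharP L p] [NeZero n] [FiniteDimensional K L] [IsGalois K L]
    (hdeg : Module.finrank K L = p ^ n) {β : TruncatedWittVector p n K}
    {x : TruncatedWittVector p n L} (hx : IsSolution β x) (σ : L ≃ₐ[K] L)
    (hσ : ∀ τ, τ ∈ Subgroup.zpowers σ) :
    ∃ c : L, c ^ p = c ∧ c ≠ 0 ∧
      (∀ i ≤ n, ∀ j : Fin n, (j : ℕ) < i → (σ ^ p ^ i) (x.coeff j) = x.coeff j) ∧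
      ∀ i : Fin n, (σ ^ p ^ (i : ℕ)) (x.coeff i) = x.coeff i + c := by
  set C := wittMap σ x - x with hC
  have hCp := frobenius_wittMap_sub hx.1 σ
  have hout : ∀ i ≤ n, ∀ j < i, (p ^ i • C).out.coeff j = 0 := by
    intro i hi j hj
    have := TruncatedWittVector.coeff_out (p ^ i • C) ⟨j, by omega⟩
    simp only at this
    rw [this]
    exact (truncated_coeff_pow_nsmul C i).1 _ hj
  have hlow : ∀ i ≤ n, ∀ j : Fin n, (j : ℕ) < i → (σ ^ p ^ i) (x.coeff j) = x.coeff j := by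
    intro i hi j hj
    have h := congrArg (fun z => z.coeff j) (wittMap_pow_eq hx.1 σ (p ^ i))
    simp only [coeff_wittMap] at h
    rw [h, truncated_coeff_add,
      (coeff_add_of_coeff_eq_zero _ _ i (hout i hi)).1 j hj,
      TruncatedWittVector.coeff_out]
  have hmid : ∀ i : Fin n, (σ ^ p ^ (i : ℕ)) (x.coeff i) = x.coeff i + C.coeff 0 := by
    intro i
    have h := congrArg (fun z => z.coeff i) (wittMap_pow_eq hx.1 σ (p ^ (i : ℕ)))
    simp only [coeff_wittMap] at h
    rw [h, truncated_coeff_add,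
      (coeff_add_of_coeff_eq_zero _ _ i (hout i i.2.le)).2,
      TruncatedWittVector.coeff_out, TruncatedWittVector.coeff_out,
      (truncated_coeff_pow_nsmul C i).2 0 i (by simp)]
    have : ∀ k : ℕ, C.coeff 0 ^ p ^ k = C.coeff 0 := by
      intro k
      induction k with
      | zero => simp
      | succ k ih => rw [pow_succ, pow_mul, ih, hCp]
    rw [this]
  refine ⟨C.coeff 0, hCp 0, fun h0 => ?_, hlow, hmid⟩
  -- If the first coordinate of `c` vanished, `σ ^ (p ^ (n - 1))` would fix all coordinates of `x`.
  have hfix : ∀ j : Fin n, (σ ^ p ^ (n - 1)) (x.coeff j) = x.coeff j := by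
    intro j
    rcases lt_or_ge (j : ℕ) (n - 1) with hj | hj
    · exact hlow _ (by omega) j hj
    · have hj' : (j : ℕ) = n - 1 := by omega
      have := hmid j
      rwa [hj', h0, add_zero] at this
  have h1 : σ ^ p ^ (n - 1) = 1 := by
    have hle : IntermediateField.adjoin K (Set.range fun i => x.coeff i) ≤
        IntermediateField.fixedField (Subgroup.zpowers (σ ^ p ^ (n - 1))) := by
      rw [IntermediateField.adjoin_le_iff]
      rintro _ ⟨j, rfl⟩
      rw [SetLike.mem_coe, IntermediateField.mem_fixedField_iff]
      intro f hf
      have : Subgroup.zpowers (σ ^ p ^ (n - 1)) ≤ MulAction.stabilizer (L ≃ₐ[K] L) (x.coeff j) := by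
        rw [Subgroup.zpowers_le]
        exact hfix j
      exact this hf
    rw [hx.2, top_le_iff] at hle
    ext z
    have hz : z ∈ IntermediateField.fixedField (Subgroup.zpowers (σ ^ p ^ (n - 1))) := by
      rw [hle]; exact IntermediateField.mem_top
    exact (IntermediateField.mem_fixedField_iff _ _).1 hz _ (Subgroup.mem_zpowers _)
  have hord : orderOf σ = p ^ n := by
    rw [orderOf_eq_card_of_forall_mem_zpowers hσ, IsGalois.card_aut_eq_finrank, hdeg]
  have hdvd := orderOf_dvd_of_pow_eq_one h1
  rw [hord] at hdvd
  have := (Nat.pow_dvd_pow_iff_le_right hp.out.one_lt).1 hdvd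
  have := Nat.pos_of_neZero n
  omega

end GaloisAction

/-! ### Determinants of powers -/

section Determinant

variable {L : Type*} [Field L]

lemma perm_eq_one_of_monotone {r : ℕ} {σ : Equiv.Perm (Fin r)} (h : Monotone σ) : σ = 1 := by
  have hs : StrictMono σ := h.strictMono_of_injective σ.injective
  have := Subsingleton.elim (hs.orderIsoOfSurjective σ σ.surjective) (OrderIso.refl (Fin r))
  ext i
  have h2 := congrArg (fun f : Fin r ≃o Fin r => f i) this
  simpa using congrArg Fin.val h2

/-- The determinant of the matrix of `p`-power powers of elements with strictly decreasing additive
valuations has the valuation of its diagonal product: by the rearrangement inequality, the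
diagonal term dominates all others. -/
lemma valuation_det_powers (w : Valuation L ℤᵐ⁰) {p : ℕ} (hp : 1 < p) {r : ℕ} (y : Fin r → L)
    (N : Fin r → ℤ) (hN : StrictMono N) (hy : ∀ k, w (y k) = WithZero.exp (N k)) (e : ℕ) :
    w (Matrix.det (Matrix.of fun k l : Fin r => y k ^ p ^ (e + (l : ℕ)))) =
      WithZero.exp (∑ k : Fin r, (p : ℤ) ^ (e + (k : ℕ)) * N k) := by
  have hterm : ∀ σ : Equiv.Perm (Fin r),
      w (Equiv.Perm.sign σ • ∏ i, (Matrix.of fun k l : Fin r => y k ^ p ^ (e + (l : ℕ))) (σ i) i) =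
        WithZero.exp (∑ k : Fin r, (p : ℤ) ^ (e + (k : ℕ)) * N (σ k)) := by
    intro σ
    have hs : ∀ z : L, w (Equiv.Perm.sign σ • z) = w z := by
      intro z
      rcases Int.units_eq_one_or (Equiv.Perm.sign σ) with h | h <;> simp [h]
    rw [hs, map_prod]
    have : ∀ s : Finset (Fin r), ∏ i ∈ s,
        w ((Matrix.of fun k l : Fin r => y k ^ p ^ (e + (l : ℕ))) (σ i) i) =
        WithZero.exp (∑ k ∈ s, (p : ℤ) ^ (e + (k : ℕ)) * N (σ k)) := by
      intro s
      induction s using Finset.induction_on with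
      | empty => simp
      | insert a s ha ih =>
        rw [Finset.prod_insert ha, Finset.sum_insert ha, ih, WithZero.exp_add, Matrix.of_apply,
          map_pow, hy, ← WithZero.exp_nsmul, nsmul_eq_mul]
        push_cast
        rfl
    exact this _
  rw [Matrix.det_apply, Valuation.map_sum_eq_of_lt w (j := (1 : Equiv.Perm (Fin r)))
    (Finset.mem_univ _), hterm]
  · simp
  · intro σ hσ
    have hσ1 : σ ≠ 1 := by simpa using hσ
    rw [hterm, hterm, WithZero.exp_lt_exp]
    have hf : StrictMono fun k : Fin r => (p : ℤ) ^ (e + (k : ℕ)) := by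
      intro a b hab
      have h1 : (1 : ℤ) < p := by exact_mod_cast hp
      exact pow_lt_pow_right₀ h1 (by have : (a : ℕ) < b := hab; omega)
    have hmv : Monovary (fun k : Fin r => (p : ℤ) ^ (e + (k : ℕ))) N := by
      intro a b hab
      exact (hf (hN.lt_iff_lt.1 hab)).le
    refine (hmv.sum_mul_comp_perm_lt_sum_mul_iff).2 fun hc => hσ1 (perm_eq_one_of_monotone ?_)
    intro a b hab
    by_contra hlt
    rw [not_le] at hlt
    have h1 := hf.le_iff_le.1 (hc (hN hlt))
    have : a = b := le_antisymm hab h1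
    subst this
    exact lt_irrefl _ hlt

/-- The determinant with columns `u, φ^e(ω), φ^(e+1)(ω), …`, where `φ` raises coordinates to the
`p`-th power. -/
def detCol (p e : ℕ) {r : ℕ} (u ω : Fin (r + 1) → L) : L :=
  Matrix.det (Matrix.of fun i j : Fin (r + 1) =>
    (Fin.cases (u i) (fun l : Fin r => ω i ^ p ^ (e + (l : ℕ))) j : L))

/-- The minor of `detCol` obtained by deleting row `i` and the first column. -/
def minor (p e : ℕ) {r : ℕ} (ω : Fin (r + 1) → L) (i : Fin (r + 1)) : L :=
  Matrix.det (Matrix.of fun k l : Fin r => ω (i.succAbove k) ^ p ^ (e + (l : ℕ)))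

lemma detCol_eq_sum (p e : ℕ) {r : ℕ} (u ω : Fin (r + 1) → L) :
    detCol p e u ω = ∑ i : Fin (r + 1), (-1) ^ (i : ℕ) * u i * minor p e ω i := by
  rw [detCol, Matrix.det_succ_column_zero]
  rfl

lemma detCol_add (p e : ℕ) {r : ℕ} (u u' ω : Fin (r + 1) → L) :
    detCol p e (u + u') ω = detCol p e u ω + detCol p e u' ω := by
  simp only [detCol_eq_sum, ← Finset.sum_add_distrib, Pi.add_apply]
  exact Finset.sum_congr rfl fun i _ => by ring

lemma detCol_smul (p e : ℕ) {r : ℕ} (c : L) (u ω : Fin (r + 1) → L) :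
    detCol p e (c • u) ω = c * detCol p e u ω := by
  simp only [detCol_eq_sum, Finset.mul_sum, Pi.smul_apply, smul_eq_mul]
  exact Finset.sum_congr rfl fun i _ => by ring

lemma detCol_eq_zero (p e : ℕ) {r : ℕ} (ω : Fin (r + 1) → L) (l : ℕ) (hl : l < r) :
    detCol p e (fun i => ω i ^ p ^ (e + l)) ω = 0 := by
  refine Matrix.det_zero_of_column_eq (i := 0) (j := Fin.succ ⟨l, hl⟩) (Fin.succ_ne_zero _).symm ?_
  intro k
  simp

lemma detCol_sum (p e : ℕ) {r : ℕ} {ι : Type*} (s : Finset ι) (u : ι → Fin (r + 1) → L)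
    (ω : Fin (r + 1) → L) : detCol p e (∑ k ∈ s, u k) ω = ∑ k ∈ s, detCol p e (u k) ω := by
  classical
  induction s using Finset.induction_on with
  | empty => simp [detCol_eq_sum]
  | insert a s ha ih => rw [Finset.sum_insert ha, Finset.sum_insert ha, detCol_add, ih]

lemma map_detCol {L' : Type*} [Field L'] (f : L →+* L') (p e : ℕ) {r : ℕ}
    (u ω : Fin (r + 1) → L) : f (detCol p e u ω) = detCol p e (f ∘ u) (f ∘ ω) := by
  rw [detCol, detCol, RingHom.map_det]
  congr 1
  ext i j
  refine Fin.cases ?_ (fun l => ?_) j <;> simp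

lemma detCol_pow {p : ℕ} [Fact p.Prime] [CharP L p] (e m : ℕ) {r : ℕ} (u ω : Fin (r + 1) → L) :
    detCol p e u ω ^ p ^ m = detCol p (m + e) (fun i => u i ^ p ^ m) ω := by
  rw [← iterateFrobenius_def, map_detCol, detCol, detCol]
  congr 1
  ext i j
  refine Fin.cases ?_ (fun l => ?_) j
  · simp [iterateFrobenius_def]
  · simp only [Function.comp_apply, iterateFrobenius_def, Matrix.of_apply, Fin.cases_succ]
    rw [← pow_mul, ← pow_add, add_assoc]

lemma iterate_artinSchreier {p : ℕ} [Fact p.Prime] [CharP L p] {a f : L} (h : a ^ p = a + f)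
    (m : ℕ) : a ^ p ^ m = a + ∑ k ∈ Finset.range m, f ^ p ^ k := by
  induction m with
  | zero => simp
  | succ m ih =>
    rw [pow_succ', pow_mul, h, add_pow_char_pow, ih, Finset.sum_range_succ, add_assoc]

/-- The error in row `j` after taking the `p ^ (r + 1)`-st power of `detCol`. -/
def rowError (p r : ℕ) (x g : L) : L := x + ∑ k ∈ Finset.range (r + 1), g ^ p ^ k

/-- If `φ(x) = x + c φ^r(ω) + g`, then all but one of the multiples of the columns `φ^k(ω)`
occurring in `φ^(r+1)(x)` cancel in the determinant. -/
lemma detCol_pow_eq {p : ℕ} [Fact p.Prime] [CharP L p] {r : ℕ} (x ω g : Fin (r + 1) → L) (c : L)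
    (h : ∀ j, x j ^ p = x j + (c * ω j ^ p ^ r + g j)) :
    detCol p 0 x ω ^ p ^ (r + 1) =
      detCol p (r + 1) (fun j => rowError p r (x j) (g j)) ω +
        c * Matrix.det (Matrix.of fun k l : Fin (r + 1) => ω k ^ p ^ (r + (l : ℕ))) := by
  have hx : (fun j => x j ^ p ^ (r + 1)) = (fun j => rowError p r (x j) (g j)) +
      (c • (fun j => ω j ^ p ^ r) +
        ∑ k ∈ Finset.range r, c ^ p ^ (k + 1) • fun j => ω j ^ p ^ (r + 1 + k)) := by
    ext j
    rw [iterate_artinSchreier (h j)]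
    simp only [Pi.add_apply, Pi.smul_apply, Finset.sum_apply, smul_eq_mul, rowError,
      add_pow_char_pow, Finset.sum_add_distrib]
    have : ∑ k ∈ Finset.range (r + 1), (c * ω j ^ p ^ r) ^ p ^ k = c * ω j ^ p ^ r +
        ∑ k ∈ Finset.range r, c ^ p ^ (k + 1) * ω j ^ p ^ (r + 1 + k) := by
      rw [Finset.sum_range_succ', pow_zero, pow_one, add_comm]
      congr 1
      refine Finset.sum_congr rfl fun k _ => ?_
      rw [mul_pow, ← pow_mul, ← pow_add]
      congr 3
      omega
    rw [this]
    ring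
  have hdet : detCol p (r + 1) (fun j => ω j ^ p ^ r) ω =
      Matrix.det (Matrix.of fun k l : Fin (r + 1) => ω k ^ p ^ (r + (l : ℕ))) := by
    rw [detCol]
    congr 1
    ext i j
    refine Fin.cases ?_ (fun l => ?_) j
    · simp
    · simp only [Matrix.of_apply, Fin.cases_succ, Fin.val_succ]
      congr 2
      omega
  rw [detCol_pow, hx, add_zero, detCol_add, detCol_add, detCol_smul, hdet, detCol_sum,
    Finset.sum_eq_zero, add_zero]
  intro k hk
  rw [detCol_smul, detCol_eq_zero _ _ _ _ (Finset.mem_range.1 hk), mul_zero]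

end Determinant

section DeterminantValuation

/-- The valuations of the minors obtained by deleting row `i`: consecutive minors differ in one row
only, so `bb`, defined by the resulting recursion, measures the pole orders of all minors against
that of the first one. -/
lemma sum_minor_add {p r : ℕ} (N : Fin (r + 1) → ℤ) (bb : ℕ → ℤ)
    (hbb : ∀ j (_ : j < r), bb (j + 1) = bb j +
      (p : ℤ) ^ (r + 1 + j) * (N ⟨j + 1, by omega⟩ - N ⟨j, by omega⟩)) (i : Fin (r + 1)) :
    ∑ k : Fin r, (p : ℤ) ^ (r + 1 + (k : ℕ)) * N (i.succAbove k) + bb i =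
      ∑ k : Fin r, (p : ℤ) ^ (r + 1 + (k : ℕ)) * N k.succ + bb 0 := by
  obtain ⟨i, hi⟩ := i
  induction i with
  | zero =>
    congr 1
  | succ i ih =>
    rw [← ih (by omega)]
    have hir : i < r := by omega
    have hsum : ∑ k : Fin r,
        ((p : ℤ) ^ (r + 1 + (k : ℕ)) * N ((⟨i, by omega⟩ : Fin (r + 1)).succAbove k) -
        (p : ℤ) ^ (r + 1 + (k : ℕ)) * N ((⟨i + 1, hi⟩ : Fin (r + 1)).succAbove k)) =
        (p : ℤ) ^ (r + 1 + i) * (N ⟨i + 1, by omega⟩ - N ⟨i, by omega⟩) := by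
      rw [Finset.sum_eq_single (⟨i, hir⟩ : Fin r)]
      · have h1 : (⟨i, by omega⟩ : Fin (r + 1)).succAbove ⟨i, hir⟩ = ⟨i + 1, by omega⟩ := by
          rw [Fin.succAbove_of_le_castSucc]
          · rfl
          · simp
        have h2 : (⟨i + 1, hi⟩ : Fin (r + 1)).succAbove ⟨i, hir⟩ = ⟨i, by omega⟩ := by
          rw [Fin.succAbove_of_castSucc_lt]
          · rfl
          · simp [Fin.lt_def]
        rw [h1, h2]
        ring
      · intro k _ hk
        have hk' : (k : ℕ) ≠ i := fun h => hk (Fin.ext h)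
        have : (⟨i, by omega⟩ : Fin (r + 1)).succAbove k =
            (⟨i + 1, hi⟩ : Fin (r + 1)).succAbove k := by
          rcases lt_or_gt_of_ne hk' with h | h
          · rw [Fin.succAbove_of_castSucc_lt, Fin.succAbove_of_castSucc_lt]
            · simp [Fin.lt_def]; omega
            · simpa [Fin.lt_def] using h
          · rw [Fin.succAbove_of_le_castSucc, Fin.succAbove_of_le_castSucc]
            · simp [Fin.le_def]; omega
            · simp [Fin.le_def]; omega
        rw [this, sub_self]
      · simp
    rw [Finset.sum_sub_distrib] at hsum
    have := hbb i hir
    simp only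
    linarith

variable {L : Type*} [Field L] (w : Valuation L ℤᵐ⁰) {p : ℕ} [hp : Fact p.Prime]
  {r : ℕ} {ω : Fin (r + 1) → L} {N : Fin (r + 1) → ℤ}

lemma valuation_minor (hN : StrictMono N) (hω : ∀ j, w (ω j) = WithZero.exp (N j)) (e : ℕ)
    (i : Fin (r + 1)) :
    w (minor p e ω i) =
      WithZero.exp (∑ k : Fin r, (p : ℤ) ^ (e + (k : ℕ)) * N (i.succAbove k)) :=
  valuation_det_powers w hp.out.one_lt (fun k => ω (i.succAbove k)) (fun k => N (i.succAbove k))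
    (hN.comp (Fin.strictMono_succAbove i)) (fun _ => hω _) e

variable {x g : Fin (r + 1) → L} {c : L} {bb : ℕ → ℤ}

/-- The valuation of the dominant term of `detCol_pow_eq`, expressed through a minor. -/
lemma valuation_main_term (hN : StrictMono N) (hN0 : N 0 = 0)
    (hω : ∀ j, w (ω j) = WithZero.exp (N j)) (hc : w c = WithZero.exp (bb 0))
    (hbb : ∀ j (_ : j < r), bb (j + 1) = bb j +
      (p : ℤ) ^ (r + 1 + j) * (N ⟨j + 1, by omega⟩ - N ⟨j, by omega⟩)) (i : Fin (r + 1)) :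
    w (c * Matrix.det (Matrix.of fun k l : Fin (r + 1) => ω k ^ p ^ (r + (l : ℕ)))) =
      WithZero.exp (bb i) * w (minor p (r + 1) ω i) := by
  rw [map_mul, hc, valuation_det_powers w hp.out.one_lt ω N hN hω r, valuation_minor w hN hω,
    ← WithZero.exp_add, ← WithZero.exp_add, add_comm (bb i), sum_minor_add N bb hbb i,
    Fin.sum_univ_succ, hN0]
  congr 1
  simp only [Fin.val_succ, mul_zero, zero_add]
  rw [add_comm]
  congr 1
  refine Finset.sum_congr rfl fun k _ => ?_
  congr 2
  omega

/-- If all row errors are small, the `p ^ (r + 1)`-st power of the determinant is dominated by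
the term of `detCol_pow_eq` that contains no errors. -/
lemma valuation_detCol_pow [CharP L p] (hN : StrictMono N) (hN0 : N 0 = 0)
    (hω : ∀ j, w (ω j) = WithZero.exp (N j)) (hc : w c = WithZero.exp (bb 0))
    (hbb : ∀ j (_ : j < r), bb (j + 1) = bb j +
      (p : ℤ) ^ (r + 1 + j) * (N ⟨j + 1, by omega⟩ - N ⟨j, by omega⟩))
    (h : ∀ j, x j ^ p = x j + (c * ω j ^ p ^ r + g j))
    (herr : ∀ j : Fin (r + 1), w (rowError p r (x j) (g j)) < WithZero.exp (bb j))
    (i : Fin (r + 1)) :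
    w (detCol p 0 x ω) ^ p ^ (r + 1) = WithZero.exp (bb i) * w (minor p (r + 1) ω i) := by
  have hmin0 : ∀ i, 0 < w (minor p (r + 1) ω i) := by
    intro i
    rw [valuation_minor w hN hω]
    exact WithZero.exp_pos
  rw [← map_pow, detCol_pow_eq x ω g c h, Valuation.map_add_eq_of_lt_right,
    valuation_main_term w hN hN0 hω hc hbb i]
  rw [detCol_eq_sum]
  refine Valuation.map_sum_lt' w ?_ fun j _ => ?_
  · rw [valuation_main_term w hN hN0 hω hc hbb i]
    exact mul_pos WithZero.exp_pos (hmin0 i)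
  · rw [valuation_main_term w hN hN0 hω hc hbb j]
    simp only [map_mul, map_pow, Valuation.map_neg, map_one, one_pow, one_mul]
    exact mul_lt_mul_of_pos_right (herr j) (hmin0 j)

/-- An upper bound for the determinant when nothing is known about the error in the last row. -/
lemma valuation_detCol_pow_le [CharP L p] (hN : StrictMono N) (hN0 : N 0 = 0)
    (hω : ∀ j, w (ω j) = WithZero.exp (N j)) (hc : w c = WithZero.exp (bb 0))
    (hbb : ∀ j (_ : j < r), bb (j + 1) = bb j +
      (p : ℤ) ^ (r + 1 + j) * (N ⟨j + 1, by omega⟩ - N ⟨j, by omega⟩))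
    (h : ∀ j, x j ^ p = x j + (c * ω j ^ p ^ r + g j))
    (herr : ∀ j : Fin (r + 1), (j : ℕ) < r →
      w (rowError p r (x j) (g j)) < WithZero.exp (bb j)) :
    w (detCol p 0 x ω) ^ p ^ (r + 1) ≤
      max (WithZero.exp (bb r)) (w (rowError p r (x (Fin.last r)) (g (Fin.last r)))) *
        w (minor p (r + 1) ω (Fin.last r)) := by
  have hle : ∀ {a b c : ℤᵐ⁰}, a ≤ b → a * c ≤ b * c := fun h => mul_le_mul_left h _
  rw [← map_pow, detCol_pow_eq x ω g c h]
  refine Valuation.map_add_le w ?_ ?_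
  · rw [detCol_eq_sum]
    refine Valuation.map_sum_le w fun j _ => ?_
    simp only [map_mul, map_pow, Valuation.map_neg, map_one, one_pow, one_mul]
    rcases lt_or_ge (j : ℕ) r with hj | hj
    · refine (hle (herr j hj).le).trans ?_
      rw [← valuation_main_term w hN hN0 hω hc hbb j,
        valuation_main_term w hN hN0 hω hc hbb (Fin.last r)]
      exact hle (le_max_left _ _)
    · have : j = Fin.last r := Fin.ext (by simp; omega)
      subst this
      exact hle (le_max_right _ _)
  · rw [valuation_main_term w hN hN0 hω hc hbb (Fin.last r)]
    exact hle (le_max_left _ _)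

end DeterminantValuation

/-- A field automorphism that fixes `ω` and all entries of `x` but the last one, to which it adds
`c`, adds `± c` to the quotient of the determinant by the minor of that entry. -/
lemma map_detCol_div_minor_sub {L : Type*} [Field L] (f : L →+* L) (p : ℕ) {r : ℕ}
    (x ω : Fin (r + 1) → L) (c : L) (hω : ∀ j, f (ω j) = ω j)
    (hx : ∀ j : Fin (r + 1), (j : ℕ) < r → f (x j) = x j)
    (hlast : f (x (Fin.last r)) = x (Fin.last r) + c)
    (hm : minor p 0 ω (Fin.last r) ≠ 0) :
    f (detCol p 0 x ω / minor p 0 ω (Fin.last r)) - detCol p 0 x ω / minor p 0 ω (Fin.last r) =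
      (-1) ^ r * c := by
  have hminor : f (minor p 0 ω (Fin.last r)) = minor p 0 ω (Fin.last r) := by
    rw [minor, RingHom.map_det]
    congr 1
    ext i j
    simp [hω]
  have hfω : f ∘ ω = ω := funext hω
  have hfx : f ∘ x = x + Pi.single (Fin.last r) c := by
    ext j
    rcases lt_or_ge (j : ℕ) r with hj | hj
    · have : j ≠ Fin.last r := fun h => by simp [h] at hj
      simp [hx j hj, this]
    · have : j = Fin.last r := Fin.ext (by simp; omega)
      subst this
      simp [hlast]
  have hs : detCol p 0 (Pi.single (Fin.last r) c) ω = (-1) ^ r * c * minor p 0 ω (Fin.last r) := by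
    rw [detCol_eq_sum, Finset.sum_eq_single (Fin.last r)]
    · simp
    · intro b _ hb
      simp [hb]
    · simp
  rw [map_div₀, map_detCol, hminor, hfω, hfx, detCol_add, hs]
  field_simp
  ring

/-! ### Expansions in powers of a uniformizer -/

lemma lt_exp_iff_le_exp_sub_one {x : ℤᵐ⁰} {k : ℤ} :
    x < WithZero.exp k ↔ x ≤ WithZero.exp (k - 1) := by
  rcases eq_or_ne x 0 with rfl | hx
  · simp only [WithZero.exp_pos, zero_le]
  · rw [← WithZero.exp_log hx, WithZero.exp_lt_exp, WithZero.exp_le_exp]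
    omega

lemma exp_pow (k : ℤ) (m : ℕ) : (WithZero.exp k : ℤᵐ⁰) ^ m = WithZero.exp (m * k) := by
  rw [← WithZero.exp_nsmul, nsmul_eq_mul]

section Expansion

variable {K L : Type*} [Field K] [Field L] [Algebra K L]

/-- A finite sum whose nonzero terms have pairwise distinct valuations is dominated by its largest
term. -/
lemma valuation_sum_of_injOn (w : Valuation L ℤᵐ⁰) {ι : Type*} [Fintype ι] (f : ι → L)
    (hinj : ∀ i j, f i ≠ 0 → f j ≠ 0 → w (f i) = w (f j) → i = j) :
    (∀ i, w (f i) ≤ w (∑ i, f i)) ∧ ((∃ i, f i ≠ 0) →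
      ∃ i, f i ≠ 0 ∧ w (∑ i, f i) = w (f i) ∧ ∀ j, j ≠ i → w (f j) < w (f i)) := by
  classical
  by_cases h0 : ∃ i, f i ≠ 0
  · obtain ⟨i₀, hi₀⟩ := h0
    obtain ⟨i, -, hi⟩ := Finset.exists_max_image Finset.univ (fun i => w (f i))
      ⟨i₀, Finset.mem_univ _⟩
    have hpos : 0 < w (f i) :=
      lt_of_lt_of_le ((Valuation.pos_iff w).2 hi₀) (hi i₀ (Finset.mem_univ _))
    have hfi : f i ≠ 0 := (Valuation.pos_iff w).1 hpos
    have hlt : ∀ j, j ≠ i → w (f j) < w (f i) := by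
      intro j hj
      rcases eq_or_ne (f j) 0 with h | h
      · rwa [h, map_zero]
      · exact lt_of_le_of_ne (hi j (Finset.mem_univ _)) fun he => hj (hinj j i h hfi he)
    have hsum : w (∑ i, f i) = w (f i) :=
      Valuation.map_sum_eq_of_lt w (Finset.mem_univ i) fun j hj => hlt j (by simpa using hj)
    exact ⟨fun j => hsum ▸ hi j (Finset.mem_univ _), fun _ => ⟨i, hfi, hsum, hlt⟩⟩
  · refine ⟨fun i => ?_, fun h => absurd h h0⟩
    rw [not_exists] at h0
    have := h0 i
    rw [not_not] at this
    simp [this]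

variable {v : Valuation K ℤᵐ⁰} {w : Valuation L ℤᵐ⁰} {e : ℕ}

lemma valuation_term (hw : ∀ a : K, w (algebraMap K L a) = v a ^ e) {ϖ : L} {r : ℤ}
    (hϖ : w ϖ = WithZero.exp r) {a : K} (ha : a ≠ 0) (k : ℕ) :
    w (algebraMap K L a * ϖ ^ k) = WithZero.exp (e * WithZero.log (v a) + k * r) := by
  have hva : v a ≠ 0 := (Valuation.ne_zero_iff v).2 ha
  rw [map_mul, map_pow, hw, hϖ, WithZero.exp_add, ← exp_pow, ← exp_pow, WithZero.exp_log hva]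

lemma term_injective (hw : ∀ a : K, w (algebraMap K L a) = v a ^ e) {ϖ : L} {r : ℤ}
    (hϖ : w ϖ = WithZero.exp r) {d : ℕ}
    (hd : ∀ k l : ℕ, k < d → l < d → (e : ℤ) ∣ (k - l : ℤ) * r → k = l)
    (a : Fin d → K) (i j : Fin d) (hi : algebraMap K L (a i) * ϖ ^ (i : ℕ) ≠ 0)
    (hj : algebraMap K L (a j) * ϖ ^ (j : ℕ) ≠ 0)
    (h : w (algebraMap K L (a i) * ϖ ^ (i : ℕ)) = w (algebraMap K L (a j) * ϖ ^ (j : ℕ))) :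
    i = j := by
  have hai : a i ≠ 0 := fun h => hi (by simp [h])
  have haj : a j ≠ 0 := fun h => hj (by simp [h])
  rw [valuation_term hw hϖ hai, valuation_term hw hϖ haj, WithZero.exp_inj] at h
  exact Fin.ext (hd i j i.2 j.2 ⟨WithZero.log (v (a j)) - WithZero.log (v (a i)), by linarith⟩)

/-- Powers of an element whose valuations are distinct modulo the ramification index are linearly
independent over the base field. -/
lemma linearIndependent_pow (hw : ∀ a : K, w (algebraMap K L a) = v a ^ e) {ϖ : L} {r : ℤ}
    (hϖ : w ϖ = WithZero.exp r) {d : ℕ}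
    (hd : ∀ k l : ℕ, k < d → l < d → (e : ℤ) ∣ (k - l : ℤ) * r → k = l) :
    LinearIndependent K fun k : Fin d => ϖ ^ (k : ℕ) := by
  rw [Fintype.linearIndependent_iff]
  intro a ha i
  simp only [Algebra.smul_def] at ha
  have h := (valuation_sum_of_injOn w _ (term_injective hw hϖ hd a)).1 i
  rw [ha, map_zero, nonpos_iff_eq_zero, Valuation.zero_iff] at h
  have hϖ0 : ϖ ≠ 0 := (Valuation.ne_zero_iff w).1 (by rw [hϖ]; exact WithZero.exp_ne_zero)
  simpa [hϖ0] using h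

lemma dvd_sub_mul_imp_eq {e d q : ℕ} (hq : 0 < q) (hdq : d * q = e) (k l : ℕ) (hk : k < d)
    (hl : l < d) (h : (e : ℤ) ∣ (k - l : ℤ) * (-(q : ℤ))) : k = l := by
  have hq' : (q : ℤ) ≠ 0 := by exact_mod_cast hq.ne'
  rw [mul_neg, dvd_neg, ← hdq, Nat.cast_mul, mul_dvd_mul_iff_right hq'] at h
  have : (k : ℤ) - l = 0 := Int.eq_zero_of_abs_lt_dvd h (by rw [abs_lt]; omega)
  omega

/-- Elements of a subextension `M` of degree `d` are expanded in powers of a uniformizer of `M`,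
with coefficients in `K`; no two terms have the same valuation. -/
lemma exists_expansion [FiniteDimensional K L] (hw : ∀ a : K, w (algebraMap K L a) = v a ^ e)
    {M : IntermediateField K L} {d q : ℕ} (hM : Module.finrank K M = d) (hq : 0 < q)
    (hdq : d * q = e) {ϖ : L} (hϖM : ϖ ∈ M) (hϖ : w ϖ = WithZero.exp (-(q : ℤ))) {z : L}
    (hz : z ∈ M) :
    ∃ a : Fin d → K, z = ∑ k, algebraMap K L (a k) * ϖ ^ (k : ℕ) ∧
      (∀ k, w (algebraMap K L (a k) * ϖ ^ (k : ℕ)) ≤ w z) ∧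
      (z ≠ 0 → ∃ k, a k ≠ 0 ∧ w z = w (algebraMap K L (a k) * ϖ ^ (k : ℕ)) ∧
        ∀ j, j ≠ k → w (algebraMap K L (a j) * ϖ ^ (j : ℕ)) < w z) := by
  have hd := dvd_sub_mul_imp_eq hq hdq
  have hli := linearIndependent_pow hw hϖ hd
  have hspan : Submodule.span K (Set.range fun k : Fin d => ϖ ^ (k : ℕ)) =
      Subalgebra.toSubmodule M.toSubalgebra := by
    apply Submodule.eq_of_le_of_finrank_eq
    · rw [Submodule.span_le]
      rintro _ ⟨k, rfl⟩
      exact pow_mem hϖM _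
    · rw [finrank_span_eq_card hli, Fintype.card_fin, ← hM]
      rfl
  have hz' : z ∈ Submodule.span K (Set.range fun k : Fin d => ϖ ^ (k : ℕ)) := by
    rw [hspan]; exact hz
  obtain ⟨a, ha⟩ := (Submodule.mem_span_range_iff_exists_fun K).1 hz'
  simp only [Algebra.smul_def] at ha
  have h := valuation_sum_of_injOn w _ (term_injective hw hϖ hd a)
  rw [ha] at h
  refine ⟨a, ha.symm, h.1, fun hz0 => ?_⟩
  obtain ⟨k, hk, h1, h2⟩ := h.2 (by
    by_contra hc
    rw [not_exists] at hc
    refine hz0 (ha.symm.trans (Finset.sum_eq_zero fun k _ => ?_))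
    exact not_not.1 (hc k))
  exact ⟨k, fun h => hk (by simp [h]), h1, fun j hj => h1 ▸ h2 j hj⟩

end Expansion

/-! ### Automorphisms of a totally ramified extension -/

section Automorphism

variable {K L : Type*} [Field K] [Field L] [Algebra K L]
  {v : Valuation K ℤᵐ⁰} {w : Valuation L ℤᵐ⁰}

/-- For `k < [L : K]` the coefficient of an integral term `a ϖ ^ k` is integral, as the valuation of
`a` in `L` is a multiple of `[L : K]`. -/
lemma valuation_coeff_le_one (hram : IsTotallyRamified K L v w) {ϖ : L}
    (hϖ : w ϖ = WithZero.exp (-1)) {a : K} {k : ℕ} (hk : k < Module.finrank K L)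
    (h : w (algebraMap K L a * ϖ ^ k) ≤ 1) : v a ≤ 1 := by
  rcases eq_or_ne a 0 with rfl | ha
  · simp
  rw [valuation_term hram hϖ ha, ← WithZero.exp_zero, WithZero.exp_le_exp] at h
  have hva : v a ≠ 0 := (Valuation.ne_zero_iff v).2 ha
  rw [← WithZero.exp_log hva, ← WithZero.exp_zero, WithZero.exp_le_exp]
  by_contra hlt
  have : (Module.finrank K L : ℤ) * 1 ≤ Module.finrank K L * WithZero.log (v a) :=
    mul_le_mul_of_nonneg_left (by omega) (by positivity)
  omega

lemma valuation_algebraMap_le_one (hram : IsTotallyRamified K L v w) {a : K} (ha : v a ≤ 1) :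
    w (algebraMap K L a) ≤ 1 := by
  rw [hram a]
  exact pow_le_one' ha _

variable [FiniteDimensional K L]

lemma exists_expansion_top (hram : IsTotallyRamified K L v w) {ϖ : L}
    (hϖ : w ϖ = WithZero.exp (-1)) (z : L) :
    ∃ a : Fin (Module.finrank K L) → K, z = ∑ k, algebraMap K L (a k) * ϖ ^ (k : ℕ) ∧
      (∀ k, w (algebraMap K L (a k) * ϖ ^ (k : ℕ)) ≤ w z) := by
  obtain ⟨a, h1, h2, -⟩ := exists_expansion (M := (⊤ : IntermediateField K L)) hram
    IntermediateField.finrank_top' one_pos (mul_one _) IntermediateField.mem_top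
    (by simpa using hϖ) (IntermediateField.mem_top (x := z))
  exact ⟨a, h1, h2⟩

/-- A uniformizer is a root of a monic integral polynomial over `K`, hence so are its conjugates. -/
lemma valuation_map_uniformizer_le_one (hram : IsTotallyRamified K L v w) {ϖ : L}
    (hϖ : w ϖ = WithZero.exp (-1)) (τ : L ≃ₐ[K] L) : w (τ ϖ) ≤ 1 := by
  obtain ⟨a, h1, h2⟩ := exists_expansion_top hram hϖ (ϖ ^ Module.finrank K L)
  have hle : (WithZero.exp (-1) : ℤᵐ⁰) ≤ 1 := by
    rw [← WithZero.exp_zero, WithZero.exp_le_exp]; omega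
  have ha : ∀ k, w (algebraMap K L (a k)) ≤ 1 := fun k =>
    valuation_algebraMap_le_one hram (valuation_coeff_le_one hram hϖ k.2
      ((h2 k).trans (by rw [map_pow, hϖ]; exact pow_le_one' hle _)))
  have h3 : τ ϖ ^ Module.finrank K L = ∑ k, algebraMap K L (a k) * τ ϖ ^ (k : ℕ) := by
    rw [← map_pow, h1, map_sum]
    simp
  by_contra hlt
  rw [not_le] at hlt
  have h4 : w (τ ϖ) ^ Module.finrank K L < w (τ ϖ) ^ Module.finrank K L := by
    conv_lhs => rw [← map_pow, h3]
    refine Valuation.map_sum_lt w (pow_ne_zero _ (zero_lt_one.trans hlt).ne') fun k _ => ?_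
    rw [map_mul, map_pow]
    calc w (algebraMap K L (a k)) * w (τ ϖ) ^ (k : ℕ) ≤ 1 * w (τ ϖ) ^ (k : ℕ) :=
          mul_le_mul_left (ha k) _
      _ = w (τ ϖ) ^ (k : ℕ) := one_mul _
      _ < w (τ ϖ) ^ Module.finrank K L := pow_lt_pow_right₀ hlt k.2
  exact lt_irrefl _ h4

lemma valuation_map_le_one (hram : IsTotallyRamified K L v w) {ϖ : L}
    (hϖ : w ϖ = WithZero.exp (-1)) (τ : L ≃ₐ[K] L) {z : L} (hz : w z ≤ 1) : w (τ z) ≤ 1 := by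
  obtain ⟨a, h1, h2⟩ := exists_expansion_top hram hϖ z
  rw [h1, map_sum]
  refine Valuation.map_sum_le w fun k _ => ?_
  rw [map_mul, map_mul, AlgEquiv.commutes, map_pow, map_pow]
  exact mul_le_one' (valuation_algebraMap_le_one hram (valuation_coeff_le_one hram hϖ k.2
    ((h2 k).trans hz))) (pow_le_one' (valuation_map_uniformizer_le_one hram hϖ τ) _)

/-- The valuation of a totally ramified extension is invariant under automorphisms. -/
lemma valuation_map_eq (hv : Function.Surjective v) (hram : IsTotallyRamified K L v w) {ϖ : L}
    (hϖ : w ϖ = WithZero.exp (-1)) (τ : L ≃ₐ[K] L) (z : L) : w (τ z) = w z := by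
  have hle : ∀ (τ : L ≃ₐ[K] L) (z : L), w (τ z) ≤ w z := by
    intro τ z
    rcases eq_or_ne z 0 with rfl | hz
    · simp
    -- Some element of `K` has the same valuation as the power `z ^ [L : K]`.
    obtain ⟨a, ha⟩ := hv (w z)
    have hd : Module.finrank K L ≠ 0 := Module.finrank_pos.ne'
    have hwa : w (algebraMap K L a) = w z ^ Module.finrank K L := by rw [hram a, ha]
    have hwz : w z ≠ 0 := (Valuation.ne_zero_iff w).2 hz
    have h1 : w (z ^ Module.finrank K L / algebraMap K L a) ≤ 1 := by
      rw [map_div₀, map_pow, hwa, div_self (pow_ne_zero _ hwz)]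
    have h2 := valuation_map_le_one hram hϖ τ h1
    rw [map_div₀, map_div₀, AlgEquiv.commutes, map_pow, map_pow, hwa,
      div_le_one₀ (zero_lt_iff.2 (pow_ne_zero _ hwz))] at h2
    exact (pow_le_pow_iff_left₀ zero_le zero_le hd).1 h2
  refine le_antisymm (hle τ z) ?_
  have := hle τ.symm (τ z)
  rwa [AlgEquiv.symm_apply_apply] at this

/-- The residue field of a totally ramified extension is that of the base field. -/
lemma exists_residue (hram : IsTotallyRamified K L v w) {ϖ : L}
    (hϖ : w ϖ = WithZero.exp (-1)) {z : L} (hz : w z ≤ 1) :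
    ∃ a : K, w (z - algebraMap K L a) ≤ WithZero.exp (-1) := by
  obtain ⟨a, h1, h2⟩ := exists_expansion_top hram hϖ z
  have hpos : 0 < Module.finrank K L := Module.finrank_pos
  refine ⟨a ⟨0, hpos⟩, ?_⟩
  have : z - algebraMap K L (a ⟨0, hpos⟩) =
      ∑ k ∈ Finset.univ.erase (⟨0, hpos⟩ : Fin (Module.finrank K L)),
        algebraMap K L (a k) * ϖ ^ (k : ℕ) := by
    rw [sub_eq_iff_eq_add, Finset.sum_erase_eq_sub (Finset.mem_univ _), ← h1]
    simp
  rw [this]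
  refine Valuation.map_sum_le w fun k hk => ?_
  rcases eq_or_ne (a k) 0 with h0 | h0
  · simp [h0]
  have h3 := (h2 k).trans hz
  rw [valuation_term hram hϖ h0, ← WithZero.exp_zero, WithZero.exp_le_exp] at h3
  rw [valuation_term hram hϖ h0, WithZero.exp_le_exp]
  have hk0 : (k : ℕ) ≠ 0 := fun h => (Finset.mem_erase.1 hk).1 (Fin.ext h)
  have hkd := k.2
  -- The exponent is nonzero since `0 < k < [L : K]`.
  have hne : (Module.finrank K L : ℤ) * WithZero.log (v (a k)) + k * (-1) ≠ 0 := by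
    intro h
    have hdvd : (Module.finrank K L : ℤ) ∣ (k : ℕ) := ⟨WithZero.log (v (a k)), by linarith⟩
    have := Nat.le_of_dvd (by omega) (Int.natCast_dvd_natCast.1 hdvd)
    omega
  omega

variable {p : ℕ} [hp : Fact p.Prime] [CharP L p]

lemma valuation_one_add_pow_sub_one_le {ε : L} (hε : w ε ≤ 1) (k : ℕ) :
    w ((1 + ε) ^ k - 1) ≤ w ε := by
  have h1 : w (1 + ε) ≤ 1 := Valuation.map_add_le w (by simp) hε
  have h := geom_sum_mul (1 + ε) k
  rw [add_sub_cancel_left] at h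
  rw [← h, map_mul]
  refine mul_le_of_le_one_left' (Valuation.map_sum_le w fun i _ => ?_)
  rw [map_pow]
  exact pow_le_one' h1 _

lemma valuation_one_add_pow_sub_one_eq {ε : L} (hε : w ε < 1) {k : ℕ} (hk : ¬ p ∣ k) :
    w ((1 + ε) ^ k - 1) = w ε := by
  have hk1 : w (k : L) = 1 := by
    refine valuation_eq_one_of_pow_eq_self (p := p) w ?_ ?_
    · rw [← frobenius_def, map_natCast]
    · rwa [Ne, CharP.cast_eq_zero_iff L p]
  have hlt : w (∑ i ∈ Finset.range k, (1 + ε) ^ i - k) < w (k : L) := by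
    have : ∑ i ∈ Finset.range k, (1 + ε) ^ i - k = ∑ i ∈ Finset.range k, ((1 + ε) ^ i - 1) := by
      rw [Finset.sum_sub_distrib]; simp
    rw [this, hk1]
    exact Valuation.map_sum_lt' w zero_lt_one fun i _ =>
      (valuation_one_add_pow_sub_one_le hε.le i).trans_lt hε
  have h := geom_sum_mul (1 + ε) k
  rw [add_sub_cancel_left] at h
  have hs : w (∑ i ∈ Finset.range k, (1 + ε) ^ i) = 1 := by
    have := Valuation.map_add_eq_of_lt_left w hlt
    rwa [add_sub_cancel, hk1] at this
  rw [← h, map_mul, hs, one_mul]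

/-- An automorphism moves the elements of a subextension `M` at least as much, relatively, as it
moves a uniformizer of `M`, and exactly as much if the normalized valuation on `M` is prime to
`p`. -/
lemma valuation_map_sub_le {e d q : ℕ} (hw : ∀ a : K, w (algebraMap K L a) = v a ^ e)
    {M : IntermediateField K L} (hM : Module.finrank K M = d) (hq : 0 < q) (hdq : d * q = e)
    {ϖ : L} (hϖM : ϖ ∈ M) (hϖ : w ϖ = WithZero.exp (-(q : ℤ))) (τ : L ≃ₐ[K] L) {ε : L}
    (hτ : τ ϖ = ϖ * (1 + ε)) (hε : w ε < 1) {z : L} (hz : z ∈ M) :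
    w (τ z - z) ≤ w z * w ε ∧
      ∀ Z : ℤ, w z = WithZero.exp Z → p ∣ d → ¬ ((p : ℤ) * q ∣ Z) → w (τ z - z) = w z * w ε := by
  obtain ⟨a, h1, h2, h3⟩ := exists_expansion hw hM hq hdq hϖM hϖ hz
  have hdiff : τ z - z = ∑ k, (algebraMap K L (a k) * ϖ ^ (k : ℕ)) * ((1 + ε) ^ (k : ℕ) - 1) := by
    conv_lhs => rw [h1]
    rw [map_sum, ← Finset.sum_sub_distrib]
    refine Finset.sum_congr rfl fun k _ => ?_
    rw [map_mul, map_pow, AlgEquiv.commutes, hτ, mul_pow]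
    ring
  constructor
  · rw [hdiff]
    refine Valuation.map_sum_le w fun k _ => ?_
    rw [map_mul]
    exact mul_le_mul' (h2 k) (valuation_one_add_pow_sub_one_le hε.le k)
  · intro Z hZ hpd hpZ
    have hwz : w z ≠ 0 := by rw [hZ]; exact WithZero.exp_ne_zero
    obtain ⟨k, hk0, hk1, hk2⟩ := h3 ((Valuation.ne_zero_iff w).1 hwz)
    have hpk : ¬ p ∣ (k : ℕ) := by
      rintro ⟨k', hk'⟩
      obtain ⟨d', rfl⟩ := hpd
      rw [hZ, valuation_term hw hϖ hk0, WithZero.exp_inj, hk', ← hdq] at hk1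
      refine hpZ ⟨d' * WithZero.log (v (a k)) - k', ?_⟩
      rw [hk1]
      push_cast
      ring
    have hmain : w ((algebraMap K L (a k) * ϖ ^ (k : ℕ)) * ((1 + ε) ^ (k : ℕ) - 1)) =
        w z * w ε := by
      rw [map_mul, ← hk1, valuation_one_add_pow_sub_one_eq hε hpk]
    rcases eq_or_ne ε 0 with rfl | hε0
    · rw [hdiff]; simp
    · rw [hdiff, Valuation.map_sum_eq_of_lt w (Finset.mem_univ k), hmain]
      intro j hj
      rw [hmain, map_mul]
      exact (mul_le_mul' le_rfl (valuation_one_add_pow_sub_one_le hε.le j)).trans_lt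
        (mul_lt_mul_of_pos_right (hk2 j (by simpa using hj)) ((Valuation.pos_iff w).2 hε0))

/-- Wild inertia is everything: automorphisms move a uniformizer by at least two steps. -/
lemma valuation_map_uniformizer_sub_le [IsGalois K L] (hv : Function.Surjective v)
    (hram : IsTotallyRamified K L v w) {n : ℕ} (hdeg : Module.finrank K L = p ^ n) {ϖ : L}
    (hϖ : w ϖ = WithZero.exp (-1)) (τ : L ≃ₐ[K] L) :
    w (τ ϖ - ϖ) ≤ WithZero.exp (-2) := by
  have hinv := valuation_map_eq hv hram hϖ
  have hwϖ : w ϖ ≠ 0 := by rw [hϖ]; exact WithZero.exp_ne_zero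
  have hϖ0 : ϖ ≠ 0 := (Valuation.ne_zero_iff w).1 hwϖ
  have hθ : ∀ τ : L ≃ₐ[K] L, w (τ ϖ / ϖ) = 1 := fun τ => by
    rw [map_div₀, hinv, div_self hwϖ]
  obtain ⟨a, ha⟩ := exists_residue hram hϖ (hθ τ).le
  have hlt1 : (WithZero.exp (-1) : ℤᵐ⁰) < 1 := by
    rw [← WithZero.exp_zero, WithZero.exp_lt_exp]; omega
  have ha1 : w (algebraMap K L a) ≤ 1 := by
    have := Valuation.map_sub_le w (hθ τ).le (ha.trans hlt1.le)
    rwa [sub_sub_cancel] at this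
  -- Modulo the maximal ideal, `τ ↦ τ ϖ / ϖ` is a homomorphism to the units of the residue field.
  have hpow : ∀ k : ℕ, w ((τ ^ k) ϖ / ϖ - algebraMap K L a ^ k) ≤ WithZero.exp (-1) := by
    intro k
    induction k with
    | zero => simp [hϖ0]
    | succ k ih =>
      have hτϖ : (τ ^ k) ϖ ≠ 0 := (map_ne_zero _).2 hϖ0
      have : (τ ^ (k + 1)) ϖ / ϖ - algebraMap K L a ^ (k + 1) =
          (τ ^ k) (τ ϖ / ϖ - algebraMap K L a) * ((τ ^ k) ϖ / ϖ) +
            algebraMap K L a * ((τ ^ k) ϖ / ϖ - algebraMap K L a ^ k) := by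
        rw [pow_succ, AlgEquiv.mul_apply, map_sub, map_div₀, AlgEquiv.commutes]
        field_simp
        ring
      rw [this]
      refine Valuation.map_add_le w ?_ ?_
      · rw [map_mul, hinv, hθ, mul_one]; exact ha
      · rw [map_mul]; exact (mul_le_of_le_one_left' ha1).trans ih
  have hcard : τ ^ p ^ n = 1 := by
    rw [← hdeg, ← IsGalois.card_aut_eq_finrank]
    exact pow_card_eq_one'
  have h1 : w (1 - algebraMap K L a) < 1 := by
    have := (hpow (p ^ n)).trans_lt hlt1
    rw [hcard, AlgEquiv.one_apply, div_self hϖ0, ← one_pow (p ^ n), ← sub_pow_char_pow,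
      map_pow] at this
    exact (pow_lt_one_iff (pow_ne_zero _ hp.out.ne_zero)).1 this
  have h2 : w (τ ϖ / ϖ - 1) < 1 := by
    have := Valuation.map_sub_lt w (ha.trans_lt hlt1) h1
    rwa [sub_sub_sub_cancel_right] at this
  have h3 : τ ϖ - ϖ = ϖ * (τ ϖ / ϖ - 1) := by field_simp
  rw [← WithZero.exp_zero, lt_exp_iff_le_exp_sub_one] at h2
  rw [h3, map_mul, hϖ, show (-2 : ℤ) = -1 + (0 - 1) by norm_num, WithZero.exp_add]
  exact mul_le_mul' le_rfl h2

end Automorphism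

/-! ### Ramification groups of a cyclic totally ramified extension -/

lemma exp_neg_le_one (k : ℕ) : (WithZero.exp (-(k : ℤ)) : ℤᵐ⁰) ≤ 1 := by
  rw [← WithZero.exp_zero, WithZero.exp_le_exp]; omega

section Ramification

variable {K L : Type*} [Field K] [Field L] [Algebra K L]

lemma map_eq_mul_one_add (τ : L ≃ₐ[K] L) {z : L} (hz : z ≠ 0) :
    τ z = z * (1 + (τ z - z) / z) := by
  field_simp
  ring

/-- The numbers `b i`, for `i < n`, are the depths of `σ ^ (p ^ i)` in the ramification filtration,
as measured on the uniformizer `ϖ`. -/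
structure IsDepthSeq (p n : ℕ) (w : Valuation L ℤᵐ⁰) (σ : L ≃ₐ[K] L) (ϖ : L) (b : ℕ → ℕ) :
    Prop where
  depth : ∀ i < n, w ((σ ^ p ^ i) ϖ - ϖ) = WithZero.exp (-((b i : ℤ) + 1))
  one_le : ∀ i < n, 1 ≤ b i
  lt : ∀ i j, i < j → j < n → b i < b j

variable [FiniteDimensional K L] [IsGalois K L]

lemma orderOf_generator {p n : ℕ} (hdeg : Module.finrank K L = p ^ n) {σ : L ≃ₐ[K] L}
    (hσ : ∀ τ, τ ∈ Subgroup.zpowers σ) : orderOf σ = p ^ n := by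
  rw [orderOf_eq_card_of_forall_mem_zpowers hσ, IsGalois.card_aut_eq_finrank, hdeg]

variable {p n : ℕ} [hp : Fact p.Prime]

lemma card_zpowers_generator_pow (hdeg : Module.finrank K L = p ^ n) {σ : L ≃ₐ[K] L}
    (hσ : ∀ τ, τ ∈ Subgroup.zpowers σ) {i : ℕ} (hi : i ≤ n) :
    Nat.card (Subgroup.zpowers (σ ^ p ^ i)) = p ^ (n - i) := by
  rw [Nat.card_zpowers, orderOf_pow_of_dvd (pow_ne_zero _ hp.out.ne_zero),
    orderOf_generator hdeg hσ, Nat.pow_div hi hp.out.pos]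
  rw [orderOf_generator hdeg hσ]
  exact pow_dvd_pow p hi

lemma generator_pow_ne_one (hdeg : Module.finrank K L = p ^ n) {σ : L ≃ₐ[K] L}
    (hσ : ∀ τ, τ ∈ Subgroup.zpowers σ) {i : ℕ} (hi : i < n) : σ ^ p ^ i ≠ 1 := by
  intro h
  have h2 := orderOf_dvd_of_pow_eq_one h
  rw [orderOf_generator hdeg hσ] at h2
  have := (Nat.pow_dvd_pow_iff_le_right hp.out.one_lt).1 h2
  omega

lemma finrank_fixedField_zpowers (hdeg : Module.finrank K L = p ^ n) {σ : L ≃ₐ[K] L}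
    (hσ : ∀ τ, τ ∈ Subgroup.zpowers σ) {i : ℕ} (hi : i ≤ n) :
    Module.finrank K (IntermediateField.fixedField (Subgroup.zpowers (σ ^ p ^ i))) = p ^ i := by
  have h1 := Module.finrank_mul_finrank K
    (IntermediateField.fixedField (Subgroup.zpowers (σ ^ p ^ i))) L
  rw [IntermediateField.finrank_fixedField_eq_card, card_zpowers_generator_pow hdeg hσ hi, hdeg,
    ← Nat.add_sub_cancel' hi, Nat.add_sub_cancel_left, pow_add] at h1
  exact Nat.eq_of_mul_eq_mul_right (pow_pos hp.out.pos _) h1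

variable [CharP L p] {v : Valuation K ℤᵐ⁰} {w : Valuation L ℤᵐ⁰}

lemma valuation_map_sub_le_of_uniformizer (hv : Function.Surjective v)
    (hram : IsTotallyRamified K L v w) (hdeg : Module.finrank K L = p ^ n) {ϖ : L}
    (hϖ : w ϖ = WithZero.exp (-1)) {τ : L ≃ₐ[K] L} {k : ℤ}
    (hτ : w (τ ϖ - ϖ) ≤ WithZero.exp (-(k + 1))) (z : L) :
    w (τ z - z) ≤ w z * WithZero.exp (-k) := by
  have hϖ0 : ϖ ≠ 0 := (Valuation.ne_zero_iff w).1 (by rw [hϖ]; exact WithZero.exp_ne_zero)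
  have hε : ∀ m : ℤ, w (τ ϖ - ϖ) ≤ WithZero.exp (-(m + 1)) →
      w ((τ ϖ - ϖ) / ϖ) ≤ WithZero.exp (-m) := by
    intro m hm
    rw [map_div₀, hϖ, ← zero_add (-m), show (0 : ℤ) + -m = -(m + 1) - (-1) by ring,
      WithZero.exp_sub]
    exact div_le_div_of_nonneg_right hm zero_le
  have hlt : w ((τ ϖ - ϖ) / ϖ) < 1 := by
    refine (hε 1 (valuation_map_uniformizer_sub_le hv hram hdeg hϖ τ)).trans_lt ?_
    rw [← WithZero.exp_zero, WithZero.exp_lt_exp]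
    omega
  have h := (valuation_map_sub_le (p := p) (M := (⊤ : IntermediateField K L)) hram
    IntermediateField.finrank_top' one_pos (mul_one _) IntermediateField.mem_top
    (by simpa using hϖ) τ (map_eq_mul_one_add τ hϖ0) hlt
    (IntermediateField.mem_top (x := z))).1
  exact h.trans (mul_le_mul' le_rfl (hε k hτ))

/-- Ramification groups are detected on a uniformizer. -/
lemma mem_lowerRamificationGroup_iff (hv : Function.Surjective v)
    (hram : IsTotallyRamified K L v w) (hdeg : Module.finrank K L = p ^ n) {ϖ : L}
    (hϖ : w ϖ = WithZero.exp (-1)) (τ : L ≃ₐ[K] L) (k : ℕ) :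
    τ ∈ lowerRamificationGroup K w k ↔ w (τ ϖ - ϖ) ≤ WithZero.exp (-((k : ℤ) + 1)) := by
  have hle : (WithZero.exp (-1) : ℤᵐ⁰) ≤ 1 := by
    rw [← WithZero.exp_zero, WithZero.exp_le_exp]; omega
  constructor
  · intro h
    exact h ϖ (hϖ.le.trans hle)
  · intro h z hz
    obtain ⟨a, ha⟩ := exists_residue hram hϖ hz
    have h1 : τ z - z = τ (z - algebraMap K L a) - (z - algebraMap K L a) := by
      rw [map_sub, AlgEquiv.commutes]; ring
    rw [h1]
    refine (valuation_map_sub_le_of_uniformizer hv hram hdeg hϖ h _).trans ?_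
    rw [show -((k : ℤ) + 1) = -1 + -k by ring, WithZero.exp_add]
    exact mul_le_mul' ha le_rfl

lemma valuation_map_sub_le_of_mem (hv : Function.Surjective v)
    (hram : IsTotallyRamified K L v w) (hdeg : Module.finrank K L = p ^ n)
    {ϖ : L} (hϖ : w ϖ = WithZero.exp (-1)) {τ : L ≃ₐ[K] L} {k : ℕ}
    (hτ : τ ∈ lowerRamificationGroup K w k) (z : L) :
    w (τ z - z) ≤ w z * WithZero.exp (-(k : ℤ)) :=
  valuation_map_sub_le_of_uniformizer hv hram hdeg hϖ
    ((mem_lowerRamificationGroup_iff hv hram hdeg hϖ τ k).1 hτ) z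

/-- Taking `p`-th powers doubles the depth in the ramification filtration. -/
lemma pow_mem_lowerRamificationGroup (hv : Function.Surjective v)
    (hram : IsTotallyRamified K L v w) (hdeg : Module.finrank K L = p ^ n)
    {ϖ : L} (hϖ : w ϖ = WithZero.exp (-1)) {τ : L ≃ₐ[K] L} {k : ℕ}
    (hτ : τ ∈ lowerRamificationGroup K w k) : τ ^ p ∈ lowerRamificationGroup K w (2 * k) := by
  have hϖ0 : ϖ ≠ 0 := (Valuation.ne_zero_iff w).1 (by rw [hϖ]; exact WithZero.exp_ne_zero)
  have hinv := valuation_map_eq hv hram hϖ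
  set ε := (τ ϖ - ϖ) / ϖ with hε
  have hτϖ : τ ϖ = ϖ * (1 + ε) := map_eq_mul_one_add τ hϖ0
  have hwε : w ε ≤ WithZero.exp (-(k : ℤ)) := by
    have := valuation_map_sub_le_of_mem hv hram hdeg hϖ hτ ϖ
    rwa [hτϖ, mul_add, mul_one, add_sub_cancel_left, map_mul,
      mul_le_mul_iff_right₀ (by rw [hϖ]; exact WithZero.exp_pos)] at this
  have hwε1 : w ε ≤ 1 := hwε.trans (exp_neg_le_one k)
  have h1ε : w (1 + ε) ≤ 1 := Valuation.map_add_le w (by simp) hwε1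
  have hkk : (WithZero.exp (-((2 * k : ℕ) : ℤ)) : ℤᵐ⁰) =
      WithZero.exp (-(k : ℤ)) * WithZero.exp (-(k : ℤ)) := by
    rw [← WithZero.exp_add]; congr 1; push_cast; ring
  -- Up to the square of `ε`, the automorphism `τ ^ j` multiplies `ϖ` by `(1 + ε) ^ j`.
  have key : ∀ j : ℕ, ∃ η, w η ≤ WithZero.exp (-((2 * k : ℕ) : ℤ)) ∧
      (τ ^ j) ϖ = ϖ * ((1 + ε) ^ j + η) := by
    intro j
    induction j with
    | zero => exact ⟨0, by simp, by simp⟩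
    | succ j ih =>
      obtain ⟨η, hη, hj⟩ := ih
      have hμ : w ((τ ^ j) ε - ε) ≤ WithZero.exp (-((2 * k : ℕ) : ℤ)) := by
        rw [hkk]
        exact (valuation_map_sub_le_of_mem hv hram hdeg hϖ (Subgroup.pow_mem _ hτ j) ε).trans
          (mul_le_mul' hwε le_rfl)
      refine ⟨(1 + ε) ^ j * ((τ ^ j) ε - ε) + η * (1 + (τ ^ j) ε), ?_, ?_⟩
      · refine Valuation.map_add_le w ?_ ?_
        · rw [map_mul, map_pow]
          exact (mul_le_of_le_one_left' (pow_le_one' h1ε _)).trans hμ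
        · rw [map_mul]
          exact (mul_le_of_le_one_right' (Valuation.map_add_le w (by simp)
            ((hinv _ _).le.trans hwε1))).trans hη
      · rw [pow_succ, AlgEquiv.mul_apply, hτϖ, map_mul, hj, map_add, map_one]
        ring
  obtain ⟨η, hη, hj⟩ := key p
  rw [mem_lowerRamificationGroup_iff hv hram hdeg hϖ, hj, add_pow_char, one_pow,
    show ϖ * (1 + ε ^ p + η) - ϖ = ϖ * (ε ^ p + η) by ring, map_mul, hϖ, neg_add,
    WithZero.exp_add, mul_comm]
  refine mul_le_mul' (Valuation.map_add_le w ?_ hη) le_rfl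
  obtain ⟨m, hm⟩ := Nat.exists_eq_add_of_le hp.out.two_le
  rw [map_pow, hm, pow_add, pow_two, hkk]
  exact (mul_le_of_le_one_right' (pow_le_one' hwε1 m)).trans (mul_le_mul' hwε hwε)

lemma exists_isDepthSeq (hv : Function.Surjective v)
    (hram : IsTotallyRamified K L v w) (hdeg : Module.finrank K L = p ^ n)
    {ϖ : L} (hϖ : w ϖ = WithZero.exp (-1)) {σ : L ≃ₐ[K] L}
    (hσ : ∀ τ, τ ∈ Subgroup.zpowers σ) : ∃ b, IsDepthSeq p n w σ ϖ b := by
  have h1 : ∀ i, ∃ b : ℕ, i < n →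
      w ((σ ^ p ^ i) ϖ - ϖ) = WithZero.exp (-((b : ℤ) + 1)) ∧ 1 ≤ b := by
    intro i
    by_cases hi : i < n
    · set τ := σ ^ p ^ i with hτ
      have hne : w (τ ϖ - ϖ) ≠ 0 := by
        intro h0
        refine generator_pow_ne_one hdeg hσ hi (AlgEquiv.ext fun z => ?_)
        by_contra hz
        have hwz : 0 < w (τ z - z) := (Valuation.pos_iff w).2 (sub_ne_zero.2 hz)
        have hz0 : w z ≠ 0 := by
          rw [Ne, Valuation.zero_iff]
          rintro rfl
          exact hz (map_zero τ)
        -- An automorphism fixing the uniformizer lies in all ramification groups.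
        have hall : ∀ k : ℤ, w (τ z - z) ≤ w z * WithZero.exp (-k) := fun k =>
          valuation_map_sub_le_of_uniformizer hv hram hdeg hϖ (by rw [h0]; exact zero_le) z
        have := hall (WithZero.log (w z) - WithZero.log (w (τ z - z)) + 1)
        rw [← WithZero.exp_log hwz.ne', ← WithZero.exp_log hz0, ← WithZero.exp_add,
          WithZero.exp_le_exp, WithZero.log_exp, WithZero.log_exp] at this
        omega
      have hle := valuation_map_uniformizer_sub_le hv hram hdeg hϖ τ
      rw [← WithZero.exp_log hne, WithZero.exp_le_exp] at hle
      refine ⟨(-WithZero.log (w (τ ϖ - ϖ)) - 1).toNat, fun _ => ⟨?_, by omega⟩⟩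
      rw [Int.toNat_of_nonneg (by omega), sub_add_cancel, neg_neg, WithZero.exp_log hne]
    · exact ⟨0, fun h => absurd h hi⟩
  choose b hb using h1
  have hsucc : ∀ i, i + 1 < n → b i < b (i + 1) := by
    intro i hi
    have hmem : σ ^ p ^ i ∈ lowerRamificationGroup K w (b i) :=
      (mem_lowerRamificationGroup_iff hv hram hdeg hϖ _ _).2 (hb i (by omega)).1.le
    have h2 := (mem_lowerRamificationGroup_iff hv hram hdeg hϖ _ _).1
      (pow_mem_lowerRamificationGroup hv hram hdeg hϖ hmem)
    rw [← pow_mul, ← pow_succ, (hb (i + 1) hi).1, WithZero.exp_le_exp] at h2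
    have := (hb i (by omega)).2
    omega
  refine ⟨b, fun i hi => (hb i hi).1, fun i hi => (hb i hi).2, fun i j hij hj => ?_⟩
  induction j, hij using Nat.le_induction with
  | base => exact hsucc i hj
  | succ j hij ih => exact (ih (by omega)).trans (hsucc j hj)

variable {σ : L ≃ₐ[K] L} {ϖ : L} {b : ℕ → ℕ}

/-- The ramification groups are the subgroups generated by the `σ ^ (p ^ i)`, and they jump at the
depths `b i`. -/
lemma lowerRamificationGroup_eq_zpowers (hv : Function.Surjective v)
    (hram : IsTotallyRamified K L v w) (hdeg : Module.finrank K L = p ^ n)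
    (hϖ : w ϖ = WithZero.exp (-1)) (hσ : ∀ τ, τ ∈ Subgroup.zpowers σ)
    (hb : IsDepthSeq p n w σ ϖ b) {i k : ℕ} (hi : i ≤ n) (hlo : ∀ j < i, b j < k)
    (hhi : i < n → k ≤ b i) : lowerRamificationGroup K w k = Subgroup.zpowers (σ ^ p ^ i) := by
  have hmem := mem_lowerRamificationGroup_iff (p := p) hv hram hdeg hϖ
  apply le_antisymm
  · intro τ hτ
    obtain ⟨m, rfl⟩ : ∃ m : ℕ, σ ^ m = τ := by
      have := hσ τ
      rw [← mem_powers_iff_mem_zpowers] at this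
      exact this
    rcases eq_or_ne m 0 with rfl | hm
    · simp
    obtain ⟨l, u, hu, rfl⟩ := Nat.exists_eq_pow_mul_and_not_dvd hm p hp.out.ne_one
    rcases le_or_gt i l with hl | hl
    · obtain ⟨l', rfl⟩ := Nat.exists_eq_add_of_le hl
      rw [pow_add, mul_assoc, pow_mul]
      exact Subgroup.npow_mem_zpowers _ _
    · exfalso
      have hco : u.Coprime (orderOf (σ ^ p ^ l)) := by
        refine Nat.Coprime.coprime_dvd_right (orderOf_pow_dvd _) ?_
        rw [orderOf_generator hdeg hσ]
        exact Nat.Coprime.pow_right _ ((hp.out.coprime_iff_not_dvd.2 hu).symm)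
      obtain ⟨m, hm⟩ := exists_pow_eq_self_of_coprime hco
      have h1 : σ ^ p ^ l ∈ lowerRamificationGroup K w k := by
        rw [← hm, ← pow_mul σ]
        exact Subgroup.pow_mem _ hτ m
      have h2 := (hmem _ _).1 h1
      rw [hb.depth l (by omega), WithZero.exp_le_exp] at h2
      have := hlo l hl
      omega
  · rw [Subgroup.zpowers_le]
    rcases hi.lt_or_eq with h | rfl
    · rw [hmem, hb.depth i h, WithZero.exp_le_exp]
      have := hhi h
      omega
    · rw [← orderOf_generator hdeg hσ, pow_orderOf_eq_one]
      exact one_mem _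

lemma isLowerBreak_iff (hv : Function.Surjective v)
    (hram : IsTotallyRamified K L v w) (hdeg : Module.finrank K L = p ^ n)
    (hϖ : w ϖ = WithZero.exp (-1)) (hσ : ∀ τ, τ ∈ Subgroup.zpowers σ)
    (hb : IsDepthSeq p n w σ ϖ b) (k : ℕ) : IsLowerBreak K w k ↔ ∃ i < n, b i = k := by
  have hmem := mem_lowerRamificationGroup_iff (p := p) hv hram hdeg hϖ
  constructor
  · intro h
    have hex : ∃ i, i = n ∨ (i < n ∧ k ≤ b i) := ⟨n, Or.inl rfl⟩
    classical
    have hspec := Nat.find_spec hex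
    have hmin := fun {m} => Nat.find_min (m := m) hex
    have hle : Nat.find hex ≤ n := Nat.find_min' hex (Or.inl rfl)
    generalize Nat.find hex = i at hspec hmin hle
    have hlo : ∀ j < i, b j < k := by
      intro j hj
      have := hmin hj
      rw [not_or, not_and, not_le] at this
      exact this.2 (by omega)
    by_contra hc
    refine h ?_
    have hne : ∀ _ : i < n, k + 1 ≤ b i := by
      intro hin
      have h1 : k ≤ b i := by omega
      have h2 : b i ≠ k := fun h2 => hc ⟨i, hin, h2⟩
      omega
    rw [lowerRamificationGroup_eq_zpowers hv hram hdeg hϖ hσ hb hle hlo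
        (fun h => (Nat.le_succ k).trans (hne h)),
      lowerRamificationGroup_eq_zpowers hv hram hdeg hϖ hσ hb hle
        (fun j hj => (hlo j hj).trans (Nat.lt_succ_self k)) hne]
  · rintro ⟨i, hi, rfl⟩ h
    have h1 : σ ^ p ^ i ∈ lowerRamificationGroup K w (b i) := (hmem _ _).2 (hb.depth i hi).le
    rw [← h, hmem, hb.depth i hi, WithZero.exp_le_exp] at h1
    push_cast at h1
    omega

lemma lowerBreak_eq (hv : Function.Surjective v)
    (hram : IsTotallyRamified K L v w) (hdeg : Module.finrank K L = p ^ n)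
    (hϖ : w ϖ = WithZero.exp (-1)) (hσ : ∀ τ, τ ∈ Subgroup.zpowers σ)
    (hb : IsDepthSeq p n w σ ϖ b) {i : ℕ} (hi : i < n) : lowerBreak K w (i + 1) = b i := by
  classical
  have hbr := isLowerBreak_iff hv hram hdeg hϖ hσ hb
  have hcount : Nat.count (IsLowerBreak K w) (b i) = i := by
    rw [Nat.count_eq_card_filter_range]
    have : (Finset.range (b i)).filter (IsLowerBreak K w) = (Finset.range i).image b := by
      ext k
      simp only [Finset.mem_filter, Finset.mem_range, Finset.mem_image, hbr]
      constructor
      · rintro ⟨hk, j, hj, rfl⟩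
        refine ⟨j, ?_, rfl⟩
        by_contra hij
        rcases (not_lt.1 hij).lt_or_eq with h | h
        · exact absurd (hb.lt i j h hj) (by omega)
        · subst h; exact lt_irrefl _ hk
      · rintro ⟨j, hj, rfl⟩
        exact ⟨hb.lt j i hj hi, j, by omega, rfl⟩
    rw [this, Finset.card_image_of_injOn, Finset.card_range]
    intro j hj l hl hjl
    have hj' : j < i := by simpa using hj
    have hl' : l < i := by simpa using hl
    by_contra hne
    rcases lt_or_gt_of_ne hne with h | h
    · exact absurd (hb.lt j l h (by omega)) (by omega)
    · exact absurd (hb.lt l j h (by omega)) (by omega)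
  have := Nat.nth_count (p := IsLowerBreak K w) ((hbr (b i)).2 ⟨i, hi, rfl⟩)
  rw [hcount] at this
  rw [lowerBreak, Nat.add_sub_cancel, this]

lemma upperBreak_one (hv : Function.Surjective v)
    (hram : IsTotallyRamified K L v w) (hdeg : Module.finrank K L = p ^ n)
    (hϖ : w ϖ = WithZero.exp (-1)) (hσ : ∀ τ, τ ∈ Subgroup.zpowers σ)
    (hb : IsDepthSeq p n w σ ϖ b) (hn : 0 < n) : upperBreak K w 1 = b 0 := by
  have hcard : ∀ k ≤ b 0, (Nat.card (lowerRamificationGroup K w k) : ℚ) = p ^ n := by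
    intro k hk
    rw [lowerRamificationGroup_eq_zpowers hv hram hdeg hϖ hσ hb (Nat.zero_le n)
      (fun j hj => absurd hj (Nat.not_lt_zero j)) (fun _ => hk),
      card_zpowers_generator_pow hdeg hσ (Nat.zero_le n)]
    simp
  have hp0 : (p : ℚ) ^ n ≠ 0 := pow_ne_zero _ (by exact_mod_cast hp.out.ne_zero)
  rw [upperBreak, lowerBreak_eq hv hram hdeg hϖ hσ hb hn, herbrand, hcard 0 (Nat.zero_le _),
    Finset.sum_congr rfl fun k hk => hcard k (Finset.mem_Icc.1 hk).2]
  simp [hp0]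

lemma upperBreak_succ (hv : Function.Surjective v)
    (hram : IsTotallyRamified K L v w) (hdeg : Module.finrank K L = p ^ n)
    (hϖ : w ϖ = WithZero.exp (-1)) (hσ : ∀ τ, τ ∈ Subgroup.zpowers σ)
    (hb : IsDepthSeq p n w σ ϖ b) {i : ℕ} (hi : i + 1 < n) :
    upperBreak K w (i + 2) = upperBreak K w (i + 1) + ((b (i + 1) : ℚ) - b i) / p ^ (i + 1) := by
  have hlt := hb.lt i (i + 1) (Nat.lt_succ_self i) hi
  have hp0 : (p : ℚ) ≠ 0 := by exact_mod_cast hp.out.ne_zero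
  have hcard : ∀ k ∈ Finset.Ioc (b i) (b (i + 1)),
      (Nat.card (lowerRamificationGroup K w k) : ℚ) = p ^ (n - (i + 1)) := by
    intro k hk
    rw [Finset.mem_Ioc] at hk
    rw [lowerRamificationGroup_eq_zpowers hv hram hdeg hϖ hσ hb hi.le ?_ (fun _ => hk.2),
      card_zpowers_generator_pow hdeg hσ hi.le]
    · simp
    · intro j hj
      rcases (Nat.lt_succ_iff.1 hj).lt_or_eq with h | h
      · exact (hb.lt j i h (by omega)).trans hk.1
      · subst h; exact hk.1
  have hcard0 : (Nat.card (lowerRamificationGroup K w 0) : ℚ) = p ^ n := by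
    rw [lowerRamificationGroup_eq_zpowers hv hram hdeg hϖ hσ hb (Nat.zero_le n)
      (fun j hj => absurd hj (Nat.not_lt_zero j)) (fun _ => Nat.zero_le _),
      card_zpowers_generator_pow hdeg hσ (Nat.zero_le n)]
    simp
  have hIcc : Finset.Icc 1 (b (i + 1)) =
      Finset.Icc 1 (b i) ∪ Finset.Ioc (b i) (b (i + 1)) := by
    ext k
    simp only [Finset.mem_Icc, Finset.mem_union, Finset.mem_Ioc]
    omega
  have hdisj : Disjoint (Finset.Icc 1 (b i)) (Finset.Ioc (b i) (b (i + 1))) := by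
    rw [Finset.disjoint_left]
    intro k hk hk'
    rw [Finset.mem_Icc] at hk
    rw [Finset.mem_Ioc] at hk'
    omega
  have hpow : (p : ℚ) ^ n = p ^ (n - (i + 1)) * p ^ (i + 1) := by
    rw [← pow_add]; congr 1; omega
  rw [upperBreak, upperBreak, lowerBreak_eq hv hram hdeg hϖ hσ hb hi,
    lowerBreak_eq hv hram hdeg hϖ hσ hb (by omega : i < n), herbrand, herbrand, hcard0, hIcc,
    Finset.sum_union hdisj, Finset.sum_congr rfl hcard, Finset.sum_const, Nat.card_Ioc,
    nsmul_eq_mul, Nat.cast_sub hlt.le, add_div]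
  congr 1
  rw [hpow]
  field_simp

/-- The norm to the fixed field `M` of `σ ^ (p ^ (i + 1))` of the uniformizer is a uniformizer of
`M`. If the next depth is large, the norm is close to a power of the uniformizer, so `σ ^ (p ^ i)`
has the same depth on `M` as on `L`. -/
lemma exists_uniformizer_fixedField (hv : Function.Surjective v)
    (hram : IsTotallyRamified K L v w) (hdeg : Module.finrank K L = p ^ n)
    (hϖ : w ϖ = WithZero.exp (-1)) (hσ : ∀ τ, τ ∈ Subgroup.zpowers σ)
    (hb : IsDepthSeq p n w σ ϖ b) {i : ℕ} (hi : i < n)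
    (hnext : i + 1 < n → p ^ (n - (i + 1)) * b i < b (i + 1)) :
    ∃ P ∈ IntermediateField.fixedField (Subgroup.zpowers (σ ^ p ^ (i + 1))),
      w P = WithZero.exp (-((p ^ (n - (i + 1)) : ℕ) : ℤ)) ∧
      ∃ ε, (σ ^ p ^ i) P = P * (1 + ε) ∧
        w ε = WithZero.exp (-((p ^ (n - (i + 1)) * b i : ℕ) : ℤ)) := by
  have hinv := valuation_map_eq hv hram hϖ
  have hwϖ : w ϖ ≠ 0 := by rw [hϖ]; exact WithZero.exp_ne_zero
  have hϖ0 : ϖ ≠ 0 := (Valuation.ne_zero_iff w).1 hwϖ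
  set q := p ^ (n - (i + 1)) with hq
  set ρ := σ ^ p ^ (i + 1) with hρ
  set τ := σ ^ p ^ i with hτ
  set c := q * b i + 1 with hc
  have hρq : ρ ^ q = 1 := by
    rw [hρ, hq, ← pow_mul, ← pow_add, Nat.add_sub_cancel' hi, ← orderOf_generator hdeg hσ,
      pow_orderOf_eq_one]
  have hρc : ρ ∈ lowerRamificationGroup K w c := by
    rcases Nat.lt_or_ge (i + 1) n with h | h
    · rw [mem_lowerRamificationGroup_iff hv hram hdeg hϖ, hρ, hb.depth _ h, WithZero.exp_le_exp]
      have := hnext h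
      omega
    · have : n = i + 1 := by omega
      rw [hρ, ← this, ← orderOf_generator hdeg hσ, pow_orderOf_eq_one]
      exact one_mem _
  have hc1 : (WithZero.exp (-(c : ℤ)) : ℤᵐ⁰) < 1 := by
    rw [← WithZero.exp_zero, WithZero.exp_lt_exp]; omega
  set y : ℕ → L := fun k => (ρ ^ k) ϖ / ϖ with hy
  have hy1 : ∀ k, w (y k - 1) ≤ WithZero.exp (-(c : ℤ)) := by
    intro k
    have h := valuation_map_sub_le_of_mem hv hram hdeg hϖ (Subgroup.pow_mem _ hρc k) ϖ
    have h2 : (ρ ^ k) ϖ - ϖ = ϖ * (y k - 1) := by simp only [hy]; field_simp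
    rwa [h2, map_mul, mul_le_mul_iff_right₀ (zero_lt_iff.2 hwϖ)] at h
  -- The product of the factors `y k` is congruent to `1` as well.
  have hprod : ∀ m : ℕ, w (∏ k ∈ Finset.range m, y k - 1) ≤ WithZero.exp (-(c : ℤ)) := by
    intro m
    induction m with
    | zero => simp
    | succ m ih =>
      have hym : w (y m) ≤ 1 := by
        simp only [hy]
        rw [map_div₀, hinv, div_self hwϖ]
      rw [Finset.prod_range_succ,
        show (∏ k ∈ Finset.range m, y k) * y m - 1 =
          (∏ k ∈ Finset.range m, y k - 1) * y m + (y m - 1) by ring]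
      refine Valuation.map_add_le w ?_ (hy1 m)
      rw [map_mul]
      exact (mul_le_of_le_one_right' hym).trans ih
  set Yy := ∏ k ∈ Finset.range q, y k with hYy
  have hYy1 := hprod q
  have hwYy : w Yy = 1 := by
    have := Valuation.map_one_add_of_lt w (hYy1.trans_lt hc1)
    rwa [add_sub_cancel] at this
  have hYy0 : Yy ≠ 0 := (Valuation.ne_zero_iff w).1 (by rw [hwYy]; exact one_ne_zero)
  set P := ϖ ^ q * Yy with hP
  have hPprod : P = ∏ k ∈ Finset.range q, (ρ ^ k) ϖ := by
    rw [hP, hYy]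
    simp only [hy]
    rw [Finset.prod_div_distrib, Finset.prod_const, Finset.card_range]
    field_simp
  have hwP : w P = WithZero.exp (-(q : ℤ)) := by
    rw [hP, map_mul, map_pow, hϖ, hwYy, mul_one, exp_pow]
    congr 1
    ring
  have hP0 : P ≠ 0 := (Valuation.ne_zero_iff w).1 (by rw [hwP]; exact WithZero.exp_ne_zero)
  have hρP : ρ P = P := by
    have h1 : ρ P * ϖ = P * ϖ := by
      rw [hPprod, map_prod]
      have h2 := Finset.prod_range_succ (fun k => (ρ ^ k) ϖ) q
      rw [Finset.prod_range_succ', hρq] at h2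
      simpa [pow_succ'] using h2
    exact mul_right_cancel₀ hϖ0 h1
  refine ⟨P, ?_, hwP, (τ P - P) / P, map_eq_mul_one_add τ hP0, ?_⟩
  · rw [IntermediateField.mem_fixedField_iff]
    intro f hf
    have : Subgroup.zpowers ρ ≤ MulAction.stabilizer (L ≃ₐ[K] L) P := by
      rw [Subgroup.zpowers_le]
      exact hρP
    exact this hf
  · set ε := (τ ϖ - ϖ) / ϖ with hε
    have hwε : w ε = WithZero.exp (-(b i : ℤ)) := by
      rw [hε, map_div₀, hτ, hb.depth i hi, hϖ, ← WithZero.exp_sub]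
      congr 1
      ring
    set ν := (τ Yy - Yy) / Yy with hν
    have hwν : w ν ≤ WithZero.exp (-(c : ℤ)) := by
      rw [hν, map_div₀, hwYy, div_one]
      have : τ Yy - Yy = τ (Yy - 1) - (Yy - 1) := by rw [map_sub, map_one]; ring
      rw [this]
      exact Valuation.map_sub_le w ((hinv _ _).le.trans hYy1) hYy1
    have hτP : (τ P - P) / P = ε ^ q + (1 + ε ^ q) * ν := by
      have h1 : τ P = ϖ ^ q * (1 + ε) ^ q * (Yy * (1 + ν)) := by
        rw [hP, map_mul, map_pow, map_eq_mul_one_add τ hϖ0, mul_pow,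
          map_eq_mul_one_add τ hYy0]
      rw [h1, hq, add_pow_char_pow, one_pow, ← hq, hP]
      field_simp
      ring
    have hwεq : w (ε ^ q) = WithZero.exp (-((q * b i : ℕ) : ℤ)) := by
      rw [map_pow, hwε, exp_pow]
      congr 1
      push_cast
      ring
    rw [hτP, Valuation.map_add_eq_of_lt_left, hwεq]
    rw [hwεq, map_mul]
    have h1 : w (1 + ε ^ q) ≤ 1 :=
      Valuation.map_add_le w (by simp) (hwεq.le.trans (exp_neg_le_one _))
    refine ((mul_le_of_le_one_left' h1).trans hwν).trans_lt ?_
    rw [WithZero.exp_lt_exp]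
    omega

end Ramification

/-! ### Breaks in terms of the Witt vector -/

section Breaks

lemma valuation_artinSchreier {L : Type*} [Field L] (w : Valuation L ℤᵐ⁰) {p : ℕ} (hp : 1 < p)
    {a f : L} (h : a ^ p = a + f) (ha : 1 < w a) : w a ^ p = w f := by
  have hlt : w a < w (a ^ p) := by
    rw [map_pow]
    simpa using pow_lt_pow_right₀ ha hp
  have hf : f = a ^ p - a := by rw [h]; ring
  rw [hf, Valuation.map_sub_eq_of_lt_left w hlt, map_pow]

lemma minor_pow {L : Type*} [Field L] {p : ℕ} [Fact p.Prime] [CharP L p] (e m : ℕ) {r : ℕ}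
    (ω : Fin (r + 1) → L) (i : Fin (r + 1)) : minor p e ω i ^ p ^ m = minor p (m + e) ω i := by
  rw [← iterateFrobenius_def, minor, minor, RingHom.map_det]
  congr 1
  ext k l
  simp only [RingHom.mapMatrix_apply, Matrix.map_apply, Matrix.of_apply, iterateFrobenius_def]
  rw [← pow_mul, ← pow_add, add_assoc, add_comm m, add_assoc, add_comm _ m]

lemma exp_pow_injective {a : ℤ} {k : ℕ} (hk : k ≠ 0) {x : ℤᵐ⁰}
    (h : x ^ k = WithZero.exp (k * a)) : x = WithZero.exp a := by
  rw [← exp_pow] at h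
  exact (pow_left_inj₀ zero_le zero_le hk).1 h

lemma valuation_pow_lt_of_le {x : ℤᵐ⁰} {E : ℤ} (hE : 0 < E) {p N k : ℕ} (hk : k ≤ N)
    (hp1 : 1 < p) (hx : x ^ p ^ N < WithZero.exp E) : x ^ p ^ k < WithZero.exp E := by
  rcases le_or_gt x 1 with h | h
  · refine (pow_le_one' h _).trans_lt ?_
    rwa [← WithZero.exp_zero, WithZero.exp_lt_exp]
  · exact (pow_le_pow_right₀ h.le (Nat.pow_le_pow_right (by omega) hk)).trans_lt hx

/-- The lower ramification breaks that belong to the upper breaks `B 0, B 1, …`. -/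
def lowerOfUpper (p : ℕ) (B : ℕ → ℤ) (i : ℕ) : ℤ :=
  B 0 + ∑ j ∈ Finset.range i, (p : ℤ) ^ (j + 1) * (B (j + 1) - B j)

lemma lowerOfUpper_succ (p : ℕ) (B : ℕ → ℤ) (i : ℕ) :
    lowerOfUpper p B (i + 1) = lowerOfUpper p B i + (p : ℤ) ^ (i + 1) * (B (i + 1) - B i) := by
  rw [lowerOfUpper, lowerOfUpper, Finset.sum_range_succ, add_assoc]

lemma not_dvd_lowerOfUpper {p : ℕ} {B : ℕ → ℤ} (h : ¬ (p : ℤ) ∣ B 0) (i : ℕ) :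
    ¬ (p : ℤ) ∣ lowerOfUpper p B i := by
  rw [lowerOfUpper, dvd_add_left]
  · exact h
  · exact Finset.dvd_sum fun j _ => Dvd.dvd.mul_right (dvd_pow_self _ (Nat.succ_ne_zero j)) _

variable {K L : Type*} [Field K] [Field L] [Algebra K L] {p n : ℕ}

/-- The Artin–Schreier–Witt equation in coordinates, together with the valuations of its main
terms: `X j` are the coordinates of the solution, `β₀ * Ω j ^ p ^ (n - 1)` and `Δ j` the main and
error terms of the Witt vector, and `D j` the cross terms of Witt vector addition. Valuations are
recorded as pole orders `m j` of `Ω j` and `B j` of the main terms. -/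
structure IsCoordinateSystem (p n : ℕ) (v : Valuation K ℤᵐ⁰) (X D : ℕ → L) (β₀ : K) (Ω Δ : ℕ → K)
    (m B : ℕ → ℤ) : Prop where
  eqn : ∀ j < n, X j ^ p = X j +
    (algebraMap K L (β₀ * Ω j ^ p ^ (n - 1)) + (algebraMap K L (Δ j) + D j))
  val_Ω : ∀ j < n, v (Ω j) = WithZero.exp (m j)
  m_zero : m 0 = 0
  B_eq : ∀ j, B j = B 0 + (p : ℤ) ^ (n - 1) * m j
  val_β₀ : v β₀ = WithZero.exp (B 0)

variable {v : Valuation K ℤᵐ⁰} {w : Valuation L ℤᵐ⁰} {X D : ℕ → L} {β₀ : K} {Ω Δ : ℕ → K}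
  {m B : ℕ → ℤ}

/-- The entries of the columns of the determinant built from the first `r + 1` rows. -/
def rowScaled (L : Type*) [Field L] [Algebra K L] (p n r : ℕ) (Ω : ℕ → K) (j : Fin (r + 1)) : L :=
  algebraMap K L (Ω j) ^ p ^ (n - (r + 1))

lemma val_rowScaled (hw : ∀ a : K, w (algebraMap K L a) = v a ^ p ^ n)
    (hC : IsCoordinateSystem p n v X D β₀ Ω Δ m B) {r : ℕ} (hr : r < n) (j : Fin (r + 1)) :
    w (rowScaled L p n r Ω j) = WithZero.exp ((p : ℤ) ^ n * ((p : ℤ) ^ (n - (r + 1)) * m j)) := by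
  rw [rowScaled, map_pow, hw, hC.val_Ω j (by omega), exp_pow, exp_pow]
  congr 1
  push_cast
  ring

lemma rowScaled_step (hC : IsCoordinateSystem p n v X D β₀ Ω Δ m B) {r : ℕ} (hr : r < n) (j : ℕ)
    (hj : j < r) :
    (p : ℤ) ^ n * lowerOfUpper p B (j + 1) = (p : ℤ) ^ n * lowerOfUpper p B j +
      (p : ℤ) ^ (r + 1 + j) * ((fun j : Fin (r + 1) => (p : ℤ) ^ n *
        ((p : ℤ) ^ (n - (r + 1)) * m j)) ⟨j + 1, by omega⟩ -
          (fun j : Fin (r + 1) => (p : ℤ) ^ n *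
        ((p : ℤ) ^ (n - (r + 1)) * m j)) ⟨j, by omega⟩) := by
  obtain ⟨s, rfl⟩ := Nat.exists_eq_add_of_lt hr
  simp only
  rw [lowerOfUpper_succ, hC.B_eq j, hC.B_eq (j + 1), show r + s + 1 - (r + 1) = s by omega,
    show r + s + 1 - 1 = r + s by omega]
  ring

lemma rowScaled_eqn (hC : IsCoordinateSystem p n v X D β₀ Ω Δ m B) {r : ℕ} (hr : r < n)
    (j : Fin (r + 1)) :
    X j ^ p = X j + (algebraMap K L β₀ * rowScaled L p n r Ω j ^ p ^ r +
      (algebraMap K L (Δ j) + D j)) := by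
  rw [hC.eqn j (by omega), rowScaled, ← pow_mul, ← pow_add, map_mul, map_pow,
    show n - (r + 1) + r = n - 1 by omega]

variable [hp : Fact p.Prime]

lemma rowScaled_strictMono (hC : IsCoordinateSystem p n v X D β₀ Ω Δ m B) {r : ℕ}
    (hB : ∀ j < r, B j < B (j + 1)) :
    StrictMono fun j : Fin (r + 1) => (p : ℤ) ^ n * ((p : ℤ) ^ (n - (r + 1)) * m j) := by
  have hp0 : (0 : ℤ) < p := by exact_mod_cast hp.out.pos
  rw [Fin.strictMono_iff_lt_succ]
  intro j
  have h := hB j j.2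
  rw [hC.B_eq j, hC.B_eq (j + 1), add_lt_add_iff_left, mul_lt_mul_iff_right₀ (pow_pos hp0 _)] at h
  exact mul_lt_mul_of_pos_left (mul_lt_mul_of_pos_left h (pow_pos hp0 _)) (pow_pos hp0 _)

/-- An element on which `σ ^ (p ^ r)` acts by a nonzero translation of the prime field, and which is
fixed by `σ ^ (p ^ (r + 1))`, has a pole of order at least the depth of `σ ^ (p ^ r)`; equality
holds if the normalized pole order is prime to `p`. -/
lemma exp_le_of_map_sub [CharP L p] [FiniteDimensional K L] [IsGalois K L]
    (hv : Function.Surjective v)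
    (hram : IsTotallyRamified K L v w) (hdeg : Module.finrank K L = p ^ n) {ϖ : L}
    (hϖ : w ϖ = WithZero.exp (-1)) {σ : L ≃ₐ[K] L} (hσ : ∀ τ, τ ∈ Subgroup.zpowers σ) {b : ℕ → ℕ}
    (hb : IsDepthSeq p n w σ ϖ b) {r : ℕ} (hr : r < n)
    (hnext : r + 1 < n → p ^ (n - (r + 1)) * b r < b (r + 1)) {z : L}
    (hz : (σ ^ p ^ (r + 1)) z = z) (hτ : w ((σ ^ p ^ r) z - z) = 1) :
    WithZero.exp ((p : ℤ) ^ (n - (r + 1)) * b r) ≤ w z ∧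
      ∀ Z : ℤ, w z = WithZero.exp ((p : ℤ) ^ (n - (r + 1)) * Z) → ¬ (p : ℤ) ∣ Z → Z = b r := by
  obtain ⟨P, hPM, hwP, ε, hε, hwε⟩ :=
    exists_uniformizer_fixedField hv hram hdeg hϖ hσ hb hr hnext
  have hzM : z ∈ IntermediateField.fixedField (Subgroup.zpowers (σ ^ p ^ (r + 1))) := by
    rw [IntermediateField.mem_fixedField_iff]
    intro f hf
    have : Subgroup.zpowers (σ ^ p ^ (r + 1)) ≤ MulAction.stabilizer (L ≃ₐ[K] L) z := by
      rw [Subgroup.zpowers_le]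
      exact hz
    exact this hf
  have hq : 0 < p ^ (n - (r + 1)) := pow_pos hp.out.pos _
  have hε1 : w ε < 1 := by
    rw [hwε, ← WithZero.exp_zero, WithZero.exp_lt_exp]
    have := Nat.mul_pos hq (hb.one_le r hr)
    omega
  obtain ⟨h1, h2⟩ := valuation_map_sub_le (p := p) (q := p ^ (n - (r + 1)))
    (fun a => (hram a).trans (by rw [hdeg])) (finrank_fixedField_zpowers hdeg hσ hr) hq
    (by rw [← pow_add]; congr 1; omega) hPM hwP _ hε hε1 hzM
  rw [hτ] at h1 h2
  have hexp : ∀ x : ℤᵐ⁰, x * w ε * WithZero.exp ((p : ℤ) ^ (n - (r + 1)) * b r) = x := by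
    intro x
    rw [hwε, mul_assoc, ← WithZero.exp_add]
    push_cast
    rw [neg_add_cancel, WithZero.exp_zero, mul_one]
  constructor
  · calc WithZero.exp ((p : ℤ) ^ (n - (r + 1)) * b r)
        = 1 * WithZero.exp ((p : ℤ) ^ (n - (r + 1)) * b r) := (one_mul _).symm
      _ ≤ w z * w ε * WithZero.exp ((p : ℤ) ^ (n - (r + 1)) * b r) := mul_le_mul_left h1 _
      _ = w z := hexp _
  · intro Z hZ hpZ
    have hq0 : (p : ℤ) ^ (n - (r + 1)) ≠ 0 := by exact_mod_cast hq.ne'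
    have h3 := h2 _ hZ (dvd_pow_self p (Nat.succ_ne_zero r)) (by
      rw [mul_comm, Nat.cast_pow, mul_dvd_mul_iff_left hq0]
      exact hpZ)
    have h4 := hexp (w z)
    rw [← h3, one_mul, hZ, WithZero.exp_inj] at h4
    exact (mul_left_cancel₀ hq0 h4).symm

lemma valuation_sum_pow_lt {g : L} {E : ℤ} (hE : 0 < E) {N r : ℕ} (hr : r ≤ N)
    (hx : w g ^ p ^ N < WithZero.exp E) :
    w (∑ k ∈ Finset.range (r + 1), g ^ p ^ k) < WithZero.exp E := by
  refine Valuation.map_sum_lt' w WithZero.exp_pos fun k hk => ?_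
  rw [map_pow]
  rw [Finset.mem_range] at hk
  exact valuation_pow_lt_of_le hE (by omega) hp.out.one_lt hx

/-- If the errors in the first `r` rows and the entries of row `r` are small, the `r`-th lower break
is the one determined by the Witt vector. The element used is the determinant formed from these
rows, divided by the minor of the last entry of the solution. -/
lemma depth_eq_lowerOfUpper [CharP L p] [FiniteDimensional K L] [IsGalois K L]
    (hv : Function.Surjective v)
    (hram : IsTotallyRamified K L v w) (hdeg : Module.finrank K L = p ^ n) {ϖ : L}
    (hϖ : w ϖ = WithZero.exp (-1)) {σ : L ≃ₐ[K] L} (hσ : ∀ τ, τ ∈ Subgroup.zpowers σ) {b : ℕ → ℕ}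
    (hb : IsDepthSeq p n w σ ϖ b) {r : ℕ} (hr : r < n)
    (hnext : r + 1 < n → p ^ (n - (r + 1)) * b r < b (r + 1))
    (hC : IsCoordinateSystem p n v X D β₀ Ω Δ m B) (hB : ∀ j < r, B j < B (j + 1))
    (hB0 : ¬ (p : ℤ) ∣ B 0) {c : L} (hc : c ^ p = c) (hc0 : c ≠ 0)
    (hfix : ∀ i ≤ n, ∀ j < i, (σ ^ p ^ i) (X j) = X j)
    (hmove : (σ ^ p ^ r) (X r) = X r + c)
    (herr : ∀ j < r, w (rowError p r (X j) (algebraMap K L (Δ j) + D j)) <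
      WithZero.exp ((p : ℤ) ^ n * lowerOfUpper p B j))
    (hXr : w (X r) < WithZero.exp ((p : ℤ) ^ n * lowerOfUpper p B r))
    (hgr : w (∑ k ∈ Finset.range (r + 1), (algebraMap K L (Δ r) + D r) ^ p ^ k) <
      WithZero.exp ((p : ℤ) ^ n * b r)) : lowerOfUpper p B r = b r := by
  have hw : ∀ a : K, w (algebraMap K L a) = v a ^ p ^ n := fun a => (hram a).trans (by rw [hdeg])
  have hp0 : (0 : ℤ) < p := by exact_mod_cast hp.out.pos
  set ω := rowScaled L p n r Ω with hω
  set x : Fin (r + 1) → L := fun j => X j with hx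
  set g : Fin (r + 1) → L := fun j => algebraMap K L (Δ j) + D j with hg
  set N : Fin (r + 1) → ℤ := fun j => (p : ℤ) ^ n * ((p : ℤ) ^ (n - (r + 1)) * m j) with hN
  have hNmono : StrictMono N := rowScaled_strictMono hC hB
  have hN0 : N 0 = 0 := by simp [hN, hC.m_zero]
  have hωN : ∀ j, w (ω j) = WithZero.exp (N j) := val_rowScaled hw hC hr
  have hβ : w (algebraMap K L β₀) = WithZero.exp ((p : ℤ) ^ n * lowerOfUpper p B 0) := by
    rw [hw, hC.val_β₀, exp_pow]
    simp [lowerOfUpper]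
  have hstep := rowScaled_step hC hr
  have heqn : ∀ j, x j ^ p = x j + (algebraMap K L β₀ * ω j ^ p ^ r + g j) := rowScaled_eqn hC hr
  set t := minor p 0 ω (Fin.last r) with ht
  have ht0 : t ≠ 0 := (Valuation.ne_zero_iff w).1 (by
    rw [ht, valuation_minor w hNmono hωN]; exact WithZero.exp_ne_zero)
  have htp : w t ^ p ^ (r + 1) = w (minor p (r + 1) ω (Fin.last r)) := by
    rw [← map_pow, ht, minor_pow, add_zero]
  have htp0 : 0 < w t ^ p ^ (r + 1) := pow_pos ((Valuation.pos_iff w).2 ht0) _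
  have hωfix : ∀ (τ : L ≃ₐ[K] L) (j : Fin (r + 1)), (τ : L →+* L) (ω j) = ω j := by
    intro τ j
    simp [hω, rowScaled]
  set z := detCol p 0 x ω / t with hz
  have hzfix : (σ ^ p ^ (r + 1)) z = z := by
    have := map_detCol_div_minor_sub ((σ ^ p ^ (r + 1) : L ≃ₐ[K] L) : L →+* L) p x ω 0 (hωfix _)
      (fun j hj => hfix _ hr j (by omega)) (by
        rw [add_zero]
        exact hfix _ hr r (Nat.lt_succ_self r)) ht0
    rw [mul_zero, sub_eq_zero] at this
    exact this
  have hzmove : w ((σ ^ p ^ r) z - z) = 1 := by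
    have := map_detCol_div_minor_sub ((σ ^ p ^ r : L ≃ₐ[K] L) : L →+* L) p x ω c (hωfix _)
      (fun j hj => hfix _ hr.le j hj) hmove ht0
    have h2 : (σ ^ p ^ r) z - z = (-1) ^ r * c := this
    rw [h2, map_mul, map_pow, Valuation.map_neg, map_one, one_pow, one_mul]
    exact valuation_eq_one_of_pow_eq_self w hc hc0
  obtain ⟨hle, heq⟩ := exp_le_of_map_sub hv hram hdeg hϖ hσ hb hr hnext hzfix hzmove
  have hpn : (p : ℤ) ^ n = (p ^ (r + 1) : ℕ) * (p : ℤ) ^ (n - (r + 1)) := by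
    push_cast
    rw [← pow_add]
    congr 1
    omega
  have hlast : w (rowError p r (x (Fin.last r)) (g (Fin.last r))) <
      WithZero.exp ((p : ℤ) ^ n * max (lowerOfUpper p B r) (b r)) := by
    have hmono : ∀ a b : ℤ, a ≤ b →
        (WithZero.exp ((p : ℤ) ^ n * a) : ℤᵐ⁰) ≤ WithZero.exp ((p : ℤ) ^ n * b) := fun a b hab => by
      rw [WithZero.exp_le_exp]
      exact mul_le_mul_of_nonneg_left hab (pow_nonneg hp0.le _)
    exact Valuation.map_add_lt w (hXr.trans_le (hmono _ _ (le_max_left _ _)))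
      (hgr.trans_le (hmono _ _ (le_max_right _ _)))
  have hzpow : w z ^ p ^ (r + 1) * w t ^ p ^ (r + 1) = w (detCol p 0 x ω) ^ p ^ (r + 1) := by
    rw [← mul_pow, ← map_mul, hz, div_mul_cancel₀ _ ht0]
  -- The pole order of `z` bounds the depth from above.
  have hbound : (b r : ℤ) ≤ lowerOfUpper p B r := by
    by_contra hlt
    rw [not_le] at hlt
    rw [max_eq_right hlt.le] at hlast
    have h1 := valuation_detCol_pow_le w (bb := fun j => (p : ℤ) ^ n * lowerOfUpper p B j)
      hNmono hN0 hωN hβ hstep heqn (fun j hj => herr j hj)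
    rw [← hzpow, ← htp, mul_le_mul_iff_left₀ htp0] at h1
    have h2 : WithZero.exp ((p : ℤ) ^ n * b r) ≤ w z ^ p ^ (r + 1) := by
      rw [hpn, mul_assoc, ← exp_pow]
      exact pow_le_pow_left₀ zero_le hle _
    refine absurd (h2.trans h1) (not_le.2 (max_lt ?_ hlast))
    rw [WithZero.exp_lt_exp]
    exact mul_lt_mul_of_pos_left hlt (pow_pos hp0 _)
  rw [max_eq_left hbound] at hlast
  have h1 := valuation_detCol_pow w (bb := fun j => (p : ℤ) ^ n * lowerOfUpper p B j)
    hNmono hN0 hωN hβ hstep heqn (fun j => by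
      rcases lt_or_ge (j : ℕ) r with hj | hj
      · exact herr j hj
      · have : j = Fin.last r := Fin.ext (by simp; omega)
        subst this
        exact hlast) (Fin.last r)
  rw [← hzpow, ← htp, mul_left_inj' htp0.ne'] at h1
  refine heq (lowerOfUpper p B r) (exp_pow_injective (pow_ne_zero (r + 1) hp.out.ne_zero) ?_)
    (not_dvd_lowerOfUpper hB0 r)
  rw [h1, ← mul_assoc, ← hpn]
  simp

end Breaks

section Induction

lemma pow_mul_le_of_forall_lt {p : ℕ} [hp : Fact p.Prime] {B : ℕ → ℤ} {i : ℕ}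
    (hpos : ∀ j ≤ i, 0 < B j)
    (hlt : ∀ j < i, p * B j < B (j + 1)) : ∀ l ≤ i, (p : ℤ) ^ (i - l) * B l ≤ B i := by
  have hp0 : (0 : ℤ) < p := by exact_mod_cast hp.out.pos
  induction i with
  | zero =>
    intro l hl
    obtain rfl : l = 0 := by omega
    simp
  | succ i ih =>
    intro l hl
    rcases hl.lt_or_eq with h | rfl
    · have h1 := ih (fun j hj => hpos j (by omega)) (fun j hj => hlt j (by omega)) l (by omega)
      rw [show i + 1 - l = (i - l) + 1 by omega, pow_succ', mul_assoc]
      exact (mul_le_mul_of_nonneg_left h1 hp0.le).trans (hlt i (by omega)).le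
    · simp

variable {K L : Type*} [Field K] [Field L] [Algebra K L] {p n : ℕ}
  {v : Valuation K ℤᵐ⁰} {w : Valuation L ℤᵐ⁰} {X D : ℕ → L} {β₀ : K} {Ω Δ : ℕ → K}
  {m B : ℕ → ℤ} {b : ℕ → ℕ}

lemma valuation_main (hw : ∀ a : K, w (algebraMap K L a) = v a ^ p ^ n)
    (hC : IsCoordinateSystem p n v X D β₀ Ω Δ m B)
    (hΔ : ∀ j < n, v (Δ j) < WithZero.exp (B j)) {j : ℕ} (hj : j < n) :
    w (algebraMap K L (β₀ * Ω j ^ p ^ (n - 1)) + algebraMap K L (Δ j)) =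
      WithZero.exp ((p : ℤ) ^ n * B j) := by
  have h1 : v (β₀ * Ω j ^ p ^ (n - 1)) = WithZero.exp (B j) := by
    rw [map_mul, map_pow, hC.val_β₀, hC.val_Ω j hj, exp_pow, ← WithZero.exp_add, hC.B_eq j]
    push_cast
    rfl
  rw [← map_add, hw, Valuation.map_add_eq_of_lt_left, h1, exp_pow]
  · push_cast; rfl
  · rw [h1]; exact hΔ j hj

/-- What is known about row `i`: the break belonging to it, the growth of the pole orders `B`, and
bounds for the entries of that row. -/
structure RowBounds (p n : ℕ) (w : Valuation L ℤᵐ⁰) (X D : ℕ → L) (Δ : ℕ → K) (B : ℕ → ℤ)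
    (b : ℕ → ℕ) (i : ℕ) : Prop where
  depth : lowerOfUpper p B i = b i
  pos : 0 < B i
  lt : ∀ j, j + 1 = i → p * B j < B i
  val_le : w (X i) ≤ WithZero.exp ((p : ℤ) ^ n * B i)
  val_lt : w (X i) < WithZero.exp ((p : ℤ) ^ n * b i)
  val_error : w (algebraMap K L (Δ i) + D i) ^ p ^ (n - 1) < WithZero.exp ((p : ℤ) ^ n * b i)

variable [hp : Fact p.Prime]

lemma RowBounds.rowError_lt {i r : ℕ} (h : RowBounds p n w X D Δ B b i) (hb : 0 < b i)
    (hr : r < n) : w (rowError p r (X i) (algebraMap K L (Δ i) + D i)) <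
      WithZero.exp ((p : ℤ) ^ n * lowerOfUpper p B i) := by
  have hp0 : (0 : ℤ) < p := by exact_mod_cast hp.out.pos
  rw [h.depth]
  exact Valuation.map_add_lt w h.val_lt (valuation_sum_pow_lt
    (mul_pos (pow_pos hp0 _) (by exact_mod_cast hb)) (by omega) h.val_error)

variable [CharP L p] [FiniteDimensional K L] [IsGalois K L] {ϖ : L} {σ : L ≃ₐ[K] L}

/-- The upper breaks are the pole orders `B i` once the lower breaks are known. -/
lemma upperBreak_eq (hv : Function.Surjective v)
    (hram : IsTotallyRamified K L v w) (hdeg : Module.finrank K L = p ^ n)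
    (hϖ : w ϖ = WithZero.exp (-1)) (hσ : ∀ τ, τ ∈ Subgroup.zpowers σ)
    (hb : IsDepthSeq p n w σ ϖ b) {i : ℕ} (hi : i < n)
    (h : ∀ j ≤ i, lowerOfUpper p B j = b j) : upperBreak K w (i + 1) = B i := by
  have hp0 : (p : ℚ) ≠ 0 := by exact_mod_cast hp.out.ne_zero
  induction i with
  | zero =>
    rw [upperBreak_one hv hram hdeg hϖ hσ hb hi]
    have := h 0 le_rfl
    rw [lowerOfUpper, Finset.sum_range_zero, add_zero] at this
    rw [this]
    simp
  | succ i ih =>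
    rw [upperBreak_succ hv hram hdeg hϖ hσ hb hi, ih (by omega) fun j hj => h j (by omega)]
    have h1 := h (i + 1) le_rfl
    rw [lowerOfUpper_succ, h i (Nat.le_succ i)] at h1
    have h2 : (b (i + 1) : ℚ) = b i + (p : ℚ) ^ (i + 1) * (B (i + 1) - B i) := by
      exact_mod_cast h1.symm
    rw [h2]
    field_simp
    ring

lemma depth_le_upperBreak (hv : Function.Surjective v)
    (hram : IsTotallyRamified K L v w) (hdeg : Module.finrank K L = p ^ n)
    (hϖ : w ϖ = WithZero.exp (-1)) (hσ : ∀ τ, τ ∈ Subgroup.zpowers σ)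
    (hb : IsDepthSeq p n w σ ϖ b) {i : ℕ} (hi : i < n) :
    (b i : ℚ) ≤ p ^ i * upperBreak K w (i + 1) := by
  have hp1 : (1 : ℚ) ≤ p := by exact_mod_cast hp.out.pos
  have hp0 : (0 : ℚ) < p := by linarith
  induction i with
  | zero => rw [upperBreak_one hv hram hdeg hϖ hσ hb hi]; simp
  | succ i ih =>
    rw [upperBreak_succ hv hram hdeg hϖ hσ hb hi, mul_add,
      mul_div_cancel₀ _ (pow_pos hp0 _).ne']
    have h1 := ih (by omega)
    have h2 : (p : ℚ) ^ i * upperBreak K w (i + 1) ≤ p ^ (i + 1) * upperBreak K w (i + 1) := by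
      rw [pow_succ, mul_assoc]
      have h0 : 0 ≤ upperBreak K w (i + 1) := by
        have : 0 ≤ (p : ℚ) ^ i * upperBreak K w (i + 1) := le_trans (Nat.cast_nonneg _) h1
        exact (mul_nonneg_iff_of_pos_left (pow_pos hp0 _)).1 this
      exact mul_le_mul_of_nonneg_left (le_mul_of_one_le_left h0 hp1) (pow_pos hp0 _).le
    linarith

/-- The hypothesis on the breaks makes consecutive depths far enough apart for
`exists_uniformizer_fixedField`. -/
lemma depth_lt_of_upperBreak_lt (hv : Function.Surjective v)
    (hram : IsTotallyRamified K L v w) (hdeg : Module.finrank K L = p ^ n)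
    (hϖ : w ϖ = WithZero.exp (-1)) (hσ : ∀ τ, τ ∈ Subgroup.zpowers σ)
    (hb : IsDepthSeq p n w σ ϖ b) {i : ℕ} (hi : i + 1 < n)
    (h : (p : ℚ) ^ n * upperBreak K w (i + 1) < b (i + 1)) :
    p ^ (n - (i + 1)) * b i < b (i + 1) := by
  have hp1 : (1 : ℚ) ≤ p := by exact_mod_cast hp.out.pos
  have hp0 : (0 : ℚ) < p := by linarith
  have h1 := depth_le_upperBreak hv hram hdeg hϖ hσ hb (by omega : i < n)
  have h0 : (0 : ℚ) ≤ p ^ i * upperBreak K w (i + 1) := le_trans (Nat.cast_nonneg _) h1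
  have h2 : (p : ℚ) ^ (n - (i + 1)) * b i < b (i + 1) := by
    calc (p : ℚ) ^ (n - (i + 1)) * b i
        ≤ p ^ (n - (i + 1)) * (p ^ i * upperBreak K w (i + 1)) :=
          mul_le_mul_of_nonneg_left h1 (pow_pos hp0 _).le
      _ ≤ p * (p ^ (n - (i + 1)) * (p ^ i * upperBreak K w (i + 1))) :=
          le_mul_of_one_le_left (mul_nonneg (pow_pos hp0 _).le h0) hp1
      _ = p ^ (1 + (n - (i + 1)) + i) * upperBreak K w (i + 1) := by ring
      _ = p ^ n * upperBreak K w (i + 1) := by congr 2; omega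
      _ < b (i + 1) := h
  exact_mod_cast h2

/-- The row bounds hold for all rows. In the inductive step, the hypothesis on the breaks forces the
pole order `B i` to be more than `p` times the previous one: otherwise the coordinate `X i`,
being moved by `σ ^ (p ^ i)` by a constant only, would show that the depth of `σ ^ (p ^ i)` is
small. -/
theorem rowBounds (hv : Function.Surjective v)
    (hram : IsTotallyRamified K L v w) (hdeg : Module.finrank K L = p ^ n)
    (hϖ : w ϖ = WithZero.exp (-1)) (hσ : ∀ τ, τ ∈ Subgroup.zpowers σ)
    (hb : IsDepthSeq p n w σ ϖ b) (hC : IsCoordinateSystem p n v X D β₀ Ω Δ m B)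
    (hred : B 0 ≤ 0 ∨ ¬ (p : ℤ) ∣ B 0) {c : L} (hc : c ^ p = c) (hc0 : c ≠ 0)
    (hfix : ∀ i ≤ n, ∀ j < i, (σ ^ p ^ i) (X j) = X j)
    (hmove : ∀ i < n, (σ ^ p ^ i) (X i) = X i + c)
    (hD0 : D 0 = 0) (hΔ0 : Δ 0 = 0)
    (hD : ∀ j < n, ∀ s : ℤ, (∀ l < j, w (X l) ≤ WithZero.exp ((p : ℤ) ^ l * s) ∧
      (p : ℤ) ^ n * B l ≤ (p : ℤ) ^ l * s) → w (D j) ≤ WithZero.exp ((p : ℤ) ^ j * s))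
    (hΔ : ∀ j < n, v (Δ j) < WithZero.exp (B j))
    (hbreak : ∀ i, i + 1 < n → (p : ℚ) ^ n * upperBreak K w (i + 1) < b (i + 1))
    (herror : ∀ i, 1 ≤ i → i < n → Δ i ≠ 0 →
      (p : ℤ) ^ (n - 1) * WithZero.log (v (Δ i)) < b i) {i : ℕ} (hi : i < n) :
    RowBounds p n w X D Δ B b i ∧ ¬ (p : ℤ) ∣ B 0 := by
  have hw : ∀ a : K, w (algebraMap K L a) = v a ^ p ^ n := fun a => (hram a).trans (by rw [hdeg])
  have hp0 : (0 : ℤ) < p := by exact_mod_cast hp.out.pos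
  have hp2 : (2 : ℤ) ≤ p := by exact_mod_cast hp.out.two_le
  have hpn0 : (0 : ℤ) < (p : ℤ) ^ n := pow_pos hp0 n
  induction i using Nat.strong_induction_on with
  | _ i ih =>
  have hnext : i + 1 < n → p ^ (n - (i + 1)) * b i < b (i + 1) := fun h =>
    depth_lt_of_upperBreak_lt hv hram hdeg hϖ hσ hb h (hbreak i h)
  have hbi : (1 : ℤ) ≤ b i := by exact_mod_cast hb.one_le i hi
  have hXlow : WithZero.exp ((p : ℤ) ^ (n - (i + 1)) * b i) ≤ w (X i) :=
    (exp_le_of_map_sub hv hram hdeg hϖ hσ hb hi hnext (hfix _ hi i (Nat.lt_succ_self i))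
      (by rw [hmove i hi, add_sub_cancel_left]; exact valuation_eq_one_of_pow_eq_self w hc hc0)).1
  have hqb : (1 : ℤ) ≤ (p : ℤ) ^ (n - (i + 1)) * b i :=
    one_le_mul_of_one_le_of_one_le (one_le_pow₀ (by omega)) hbi
  have hX1 : 1 < w (X i) := by
    refine lt_of_lt_of_le ?_ hXlow
    rw [← WithZero.exp_zero, WithZero.exp_lt_exp]
    omega
  have hXp : w (X i) ^ p = w (algebraMap K L (β₀ * Ω i ^ p ^ (n - 1)) + algebraMap K L (Δ i) +
      D i) := by
    rw [add_assoc]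
    exact valuation_artinSchreier w hp.out.one_lt (hC.eqn i hi) hX1
  have hmain := valuation_main hw hC hΔ hi
  -- All row bounds follow from those for `B i` and the last entry of the row.
  have hfinish : w (X i) ^ p = WithZero.exp ((p : ℤ) ^ n * B i) → (∀ j, j + 1 = i → p * B j < B i) →
      B i < p * lowerOfUpper p B i →
      w (algebraMap K L (Δ i) + D i) ^ p ^ (n - 1) < WithZero.exp ((p : ℤ) ^ n * b i) →
      RowBounds p n w X D Δ B b i ∧ ¬ (p : ℤ) ∣ B 0 := by
    intro h1 h2 h3 h4
    have hle : w (X i) ≤ WithZero.exp ((p : ℤ) ^ n * B i) := by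
      rw [← h1]
      exact le_self_pow₀ hX1.le hp.out.ne_zero
    have hpos : 0 < B i := by
      have := hX1.trans_le hle
      rw [← WithZero.exp_zero, WithZero.exp_lt_exp] at this
      exact (mul_pos_iff_of_pos_left hpn0).1 this
    have hB0 : ¬ (p : ℤ) ∣ B 0 := by
      rcases Nat.eq_zero_or_pos i with rfl | h0
      · exact hred.resolve_left (not_le.2 hpos)
      · exact (ih 0 h0 (by omega)).2
    have hlt : w (X i) < WithZero.exp ((p : ℤ) ^ n * lowerOfUpper p B i) := by
      by_contra hge
      rw [not_lt] at hge
      have h5 := pow_le_pow_left₀ zero_le hge p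
      rw [h1, exp_pow, WithZero.exp_le_exp, mul_left_comm, mul_le_mul_iff_right₀ hpn0] at h5
      omega
    have hdepth := depth_eq_lowerOfUpper hv hram hdeg hϖ hσ hb hi hnext hC
      (fun j hj => by
        have h5 := (ih j (by omega) (by omega)).1.pos
        have h6 : p * B j < B (j + 1) := by
          rcases (Nat.succ_le_of_lt hj).lt_or_eq with h | h
          · exact (ih (j + 1) h (by omega)).1.lt j rfl
          · have := h2 j h
            rw [← h] at this
            exact this
        nlinarith) hB0 hc hc0 hfix (hmove i hi)
      (fun j hj => (ih j hj (by omega)).1.rowError_lt (hb.one_le j (by omega)) hi) hlt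
      (valuation_sum_pow_lt (mul_pos hpn0 (by omega)) (by omega : i ≤ n - 1) h4)
    exact ⟨⟨hdepth, hpos, h2, hle, hdepth ▸ hlt, h4⟩, hB0⟩
  rcases Nat.eq_zero_or_pos i with rfl | h0
  · have h1 : w (X 0) ^ p = WithZero.exp ((p : ℤ) ^ n * B 0) := by
      rw [hXp, hD0, add_zero, hmain]
    have hpos : 0 < B 0 := by
      have := one_lt_pow₀ hX1 hp.out.ne_zero
      rw [h1, ← WithZero.exp_zero, WithZero.exp_lt_exp] at this
      exact (mul_pos_iff_of_pos_left hpn0).1 this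
    refine hfinish h1 (fun j hj => absurd hj (Nat.succ_ne_zero j)) ?_ ?_
    · rw [lowerOfUpper, Finset.sum_range_zero, add_zero]
      nlinarith
    · rw [hD0, hΔ0, map_zero, add_zero, map_zero,
        zero_pow (pow_ne_zero _ hp.out.ne_zero)]
      exact WithZero.exp_pos
  · obtain ⟨k, rfl⟩ : ∃ k, i = k + 1 := ⟨i - 1, by omega⟩
    have hk := (ih k (Nat.lt_succ_self k) (by omega)).1
    -- The upper break before the `i`-th is known by induction.
    have hbk : (p : ℤ) ^ n * B k < b (k + 1) := by
      have h1 := hbreak k hi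
      rw [upperBreak_eq (B := B) hv hram hdeg hϖ hσ hb (by omega)
        fun j hj => (ih j (by omega) (by omega)).1.depth] at h1
      exact_mod_cast h1
    have hchain := pow_mul_le_of_forall_lt (p := p) (B := B) (i := k)
      (fun j hj => (ih j (by omega) (by omega)).1.pos)
      (fun j hj => (ih (j + 1) (by omega) (by omega)).1.lt j rfl)
    have hDk : w (D (k + 1)) ≤ WithZero.exp ((p : ℤ) ^ (n + 1) * B k) := by
      have h1 := hD (k + 1) hi ((p : ℤ) ^ (n - k) * B k) ?_
      · rwa [← mul_assoc, ← pow_add, show k + 1 + (n - k) = n + 1 by omega] at h1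
      intro l hl
      have h2 : (p : ℤ) ^ n * B l ≤ (p : ℤ) ^ l * ((p : ℤ) ^ (n - k) * B k) := by
        have h3 := mul_le_mul_of_nonneg_left (hchain l (by omega))
          (pow_nonneg hp0.le (l + (n - k)))
        rw [← mul_assoc, ← pow_add, show l + (n - k) + (k - l) = n by omega] at h3
        rwa [← mul_assoc, ← pow_add]
      refine ⟨((ih l (by omega) (by omega)).1.val_le).trans ?_, h2⟩
      rwa [WithZero.exp_le_exp]
    have hBlt : p * B k < B (k + 1) := by
      by_contra hge
      rw [not_lt] at hge
      have h1 : w (X (k + 1)) ^ p ≤ WithZero.exp ((p : ℤ) ^ (n + 1) * B k) := by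
        rw [hXp]
        refine Valuation.map_add_le w ?_ hDk
        rw [hmain, WithZero.exp_le_exp, pow_succ, mul_assoc]
        exact mul_le_mul_of_nonneg_left hge hpn0.le
      have h2 := (pow_le_pow_left₀ zero_le hXlow p).trans h1
      rw [exp_pow, WithZero.exp_le_exp, pow_succ', mul_assoc, mul_le_mul_iff_right₀ hp0] at h2
      have h3 : (b (k + 1) : ℤ) ≤ (p : ℤ) ^ (n - (k + 1 + 1)) * b (k + 1) :=
        le_mul_of_one_le_left (by omega) (one_le_pow₀ (by omega))
      omega
    have hBk := hk.pos
    refine hfinish ?_ (fun j hj => Nat.succ.inj hj ▸ hBlt) ?_ ?_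
    · rw [hXp, Valuation.map_add_eq_of_lt_left, hmain]
      rw [hmain]
      refine hDk.trans_lt ?_
      rw [WithZero.exp_lt_exp, pow_succ, mul_assoc]
      exact mul_lt_mul_of_pos_left hBlt hpn0
    · rw [lowerOfUpper_succ, hk.depth]
      have h1 : B (k + 1) - B k ≤ (p : ℤ) ^ (k + 1) * (B (k + 1) - B k) :=
        le_mul_of_one_le_left (by nlinarith) (one_le_pow₀ (by omega))
      have h2 := hb.one_le k (by omega)
      have h3 : p * (B (k + 1) - B k) ≤ p * ((b k : ℤ) + (p : ℤ) ^ (k + 1) * (B (k + 1) - B k)) :=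
        mul_le_mul_of_nonneg_left (by omega) hp0.le
      have h4 : 0 ≤ ((p : ℤ) - 2) * B (k + 1) :=
        mul_nonneg (by omega) ((mul_pos hp0 hBk).trans hBlt).le
      linarith
    · rw [← map_pow, add_pow_char_pow]
      refine Valuation.map_add_lt w ?_ ?_
      · rcases eq_or_ne (Δ (k + 1)) 0 with h | h
        · rw [h, map_zero, zero_pow (pow_ne_zero _ hp.out.ne_zero), map_zero]
          exact WithZero.exp_pos
        · have h1 := herror (k + 1) (by omega) hi h
          have hv0 : v (Δ (k + 1)) ≠ 0 := (Valuation.ne_zero_iff v).2 h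
          rw [map_pow, hw, ← pow_mul, ← WithZero.exp_log hv0, exp_pow, WithZero.exp_lt_exp]
          push_cast
          rw [mul_assoc]
          exact mul_lt_mul_of_pos_left h1 hpn0
      · rw [map_pow]
        refine (pow_le_pow_left₀ zero_le hDk _).trans_lt ?_
        rw [exp_pow, WithZero.exp_lt_exp]
        have h1 : ((p ^ (n - 1) : ℕ) : ℤ) * ((p : ℤ) ^ (n + 1) * B k) =
            (p : ℤ) ^ n * ((p : ℤ) ^ n * B k) := by
          push_cast
          rw [← mul_assoc, ← mul_assoc, ← pow_add, ← pow_add]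
          congr 2
          omega
        rw [h1]
        exact mul_lt_mul_of_pos_left hbk hpn0

end Induction

/-! ### The valuation of the determinant -/

section Generation

variable {K L : Type*} [Field K] [Field L] [Algebra K L] {p n : ℕ}

lemma elementY_eq_detCol {r : ℕ} (ω : Fin (r + 1) → K) (x : TruncatedWittVector p (r + 1) L)
    {Ω : ℕ → K} {X : ℕ → L} (hΩ : ∀ j : Fin (r + 1), Ω j = ω j)
    (hX : ∀ j : Fin (r + 1), X j = x.coeff j) :
    elementY p ω x = detCol p 0 (fun j : Fin (r + 1) => X j) (rowScaled L p (r + 1) r Ω) := by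
  rw [elementY, detCol]
  congr 1
  ext i j
  refine Fin.cases ?_ (fun l => ?_) j
  · simp [matrixY, hX]
  · simp [matrixY, rowScaled, hΩ]

variable [hp : Fact p.Prime] {v : Valuation K ℤᵐ⁰} {w : Valuation L ℤᵐ⁰}

/-- An element of a totally ramified extension of `p`-power degree generates the extension if its
valuation is prime to `p`. -/
lemma adjoin_eq_top_of_not_dvd [FiniteDimensional K L] (hram : IsTotallyRamified K L v w)
    (hdeg : Module.finrank K L = p ^ n) {y : L} {W : ℤ} (hy : w y = WithZero.exp W)
    (hW : ¬ (p : ℤ) ∣ W) : IntermediateField.adjoin K {y} = ⊤ := by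
  have hw : ∀ a : K, w (algebraMap K L a) = v a ^ p ^ n := fun a => (hram a).trans (by rw [hdeg])
  have hcop : IsCoprime (p ^ n : ℤ) W :=
    ((Nat.prime_iff_prime_int.1 hp.out).coprime_iff_not_dvd.2 hW).pow_left
  have hli := linearIndependent_pow hw hy (d := p ^ n) fun k l hk hl h => by
    have h1 : ((p ^ n : ℕ) : ℤ) ∣ (k : ℤ) - l := by
      push_cast at h ⊢
      exact hcop.dvd_of_dvd_mul_right h
    have : (k : ℤ) - l = 0 := Int.eq_zero_of_abs_lt_dvd h1 (by rw [abs_lt]; omega)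
    omega
  set M := IntermediateField.adjoin K {y} with hM
  have hyM : y ∈ M := IntermediateField.mem_adjoin_simple_self K y
  have hliM : LinearIndependent K fun k : Fin (p ^ n) => (⟨y, hyM⟩ : M) ^ (k : ℕ) :=
    LinearIndependent.of_comp M.val.toLinearMap hli
  have hcard := hliM.fintype_card_le_finrank
  rw [Fintype.card_fin, ← hdeg] at hcard
  refine IntermediateField.eq_of_le_of_finrank_le le_top ?_
  rwa [IntermediateField.finrank_top']

/-- The valuation of the full determinant. -/
lemma valuation_detCol_of_rowBounds [CharP L p] {r : ℕ} {X D : ℕ → L} {β₀ : K} {Ω Δ : ℕ → K}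
    {m B : ℕ → ℤ} {b : ℕ → ℕ} (hw : ∀ a : K, w (algebraMap K L a) = v a ^ p ^ (r + 1))
    (hC : IsCoordinateSystem p (r + 1) v X D β₀ Ω Δ m B)
    (hb : ∀ i < r + 1, 0 < b i) (h : ∀ i < r + 1, RowBounds p (r + 1) w X D Δ B b i) :
    w (detCol p 0 (fun j : Fin (r + 1) => X j) (rowScaled L p (r + 1) r Ω)) =
      WithZero.exp (B 0 + ∑ k : Fin r, (p : ℤ) ^ (r + 1 + (k : ℕ)) * m (k + 1)) := by
  have hp0 : (0 : ℤ) < p := by exact_mod_cast hp.out.pos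
  have hB : ∀ j < r, B j < B (j + 1) := fun j hj => by
    have h1 := (h (j + 1) (by omega)).lt j rfl
    have h2 := (h j (by omega)).pos
    exact (le_mul_of_one_le_left h2.le (by omega)).trans_lt h1
  set N : Fin (r + 1) → ℤ :=
    fun j => (p : ℤ) ^ (r + 1) * ((p : ℤ) ^ (r + 1 - (r + 1)) * m j) with hN
  have hβ : w (algebraMap K L β₀) =
      WithZero.exp ((p : ℤ) ^ (r + 1) * lowerOfUpper p B 0) := by
    rw [hw, hC.val_β₀, exp_pow]
    simp [lowerOfUpper]
  have h1 := valuation_detCol_pow w (bb := fun j => (p : ℤ) ^ (r + 1) * lowerOfUpper p B j)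
    (N := N) (rowScaled_strictMono hC hB) (by simp [hN, hC.m_zero])
    (val_rowScaled hw hC (Nat.lt_succ_self r)) hβ (rowScaled_step hC (Nat.lt_succ_self r))
    (rowScaled_eqn hC (Nat.lt_succ_self r))
    (fun j => (h j j.2).rowError_lt (hb j j.2) (Nat.lt_succ_self r)) 0
  rw [valuation_minor w (rowScaled_strictMono hC hB) (val_rowScaled hw hC (Nat.lt_succ_self r)),
    ← WithZero.exp_add] at h1
  refine exp_pow_injective (pow_ne_zero (r + 1) hp.out.ne_zero) (h1.trans ?_)
  congr 1
  rw [mul_add, Finset.mul_sum]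
  push_cast
  congr 1
  · simp [lowerOfUpper]
  · refine Finset.sum_congr rfl fun k _ => ?_
    simp only [Fin.succAbove_zero, Fin.val_succ, Nat.sub_self, pow_zero, one_mul]
    ring

/-- The cross terms of the sum of two Witt vectors in terms of pole orders. -/
lemma valuation_cross_term_le_exp [CharP L p] (hw : Function.Surjective w) (x y : WittVector p L)
    (j : ℕ) (s : ℤ) (hx : ∀ l < j, w (x.coeff l) ≤ WithZero.exp ((p : ℤ) ^ l * s))
    (hy : ∀ l < j, w (y.coeff l) ≤ WithZero.exp ((p : ℤ) ^ l * s)) :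
    w ((x + y).coeff j - x.coeff j - y.coeff j) ≤ WithZero.exp ((p : ℤ) ^ j * s) := by
  obtain ⟨a, ha⟩ := hw (WithZero.exp (-s))
  have hscale : ∀ (l : ℕ) (z : ℤᵐ⁰), w a ^ p ^ l * z ≤ 1 ↔
      z ≤ WithZero.exp ((p : ℤ) ^ l * s) := by
    intro l z
    rw [ha, exp_pow]
    push_cast
    rw [mul_neg, WithZero.exp_neg, inv_mul_le_iff₀ WithZero.exp_pos, mul_one]
  rw [← hscale]
  exact valuation_cross_term_le w x y j a (fun l hl => (hscale l _).2 (hx l hl))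
    (fun l hl => (hscale l _).2 (hy l hl))

end Generation

end ASW

open ASW
theorem mainTheorem4 {p n : ℕ} [Fact p.Prime] [NeZero n]
    -- a local field `K` of characteristic `p`: complete, with normalized discrete valuation
    {K : Type*} [Field K] [CharP K p] [Valued K ℤᵐ⁰] [CompleteSpace K]
    (hv : Function.Surjective (Valued.v : Valuation K ℤᵐ⁰))
    [PerfectField (Valued.ResidueField K)]
    -- a totally ramified cyclic extension `L / K` of degree `p ^ n`
    {L : Type*} [Field L] [Algebra K L] [FiniteDimensional K L] [IsGalois K L]
    [IsCyclic (L ≃ₐ[K] L)] (hdeg : Module.finrank K L = p ^ n)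
    (w : Valuation L ℤᵐ⁰) (hw : Function.Surjective w)
    (hram : IsTotallyRamified K L Valued.v w)
    -- a reduced Witt vector corresponding to `L / K`, and a solution `x`
    (β : TruncatedWittVector p n K) (hred : IsReducedWitt Valued.v β)
    (x : TruncatedWittVector p n L) (hx : IsSolution β x)
    -- the decomposition into main terms and error terms
    (ω δ : Fin n → K) (hω0 : ω 0 = 1) (hδ0 : δ 0 = 0)
    (hβ : ∀ i, β.coeff i = β.coeff 0 * ω i ^ p ^ (n - 1) + δ i)
    (hδ : ∀ i, Valued.v (δ i) < Valued.v (β.coeff i))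
    -- the assumptions on the ramification breaks, for `1 ≤ i ≤ n - 1`
    (hbreak : ∀ i : ℕ, 1 ≤ i → i ≤ n - 1 →
      (p : ℚ) ^ n * upperBreak K w i < lowerBreak K w (i + 1))
    (herror : ∀ i : Fin n, 1 ≤ (i : ℕ) → δ i ≠ 0 →
      -(p : ℤ) ^ (n - 1) * ord Valued.v (δ i) < lowerBreak K w (i + 1))
    (m : Fin n → ℤ) (hm : ∀ i, m i = -ord Valued.v (ω i)) :
    IntermediateField.adjoin K {elementY p ω x} = ⊤ ∧
      elementY p ω x ≠ 0 ∧
      ord w (elementY p ω x) =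
        -(lowerBreak K w 1 : ℤ) -
          ∑ i ∈ Finset.univ.filter (fun i : Fin n => 1 ≤ (i : ℕ)),
            (p : ℤ) ^ (n - 1 + (i : ℕ)) * m i := by
  have hp : Nat.Prime p := Fact.out
  have hn : 0 < n := Nat.pos_of_neZero n
  have hcharL : CharP L p := charP_of_injective_algebraMap (algebraMap K L).injective p
  set v : Valuation K ℤᵐ⁰ := Valued.v with hvdef
  have hw' : ∀ a : K, w (algebraMap K L a) = v a ^ p ^ n := fun a => (hram a).trans (by rw [hdeg])
  obtain ⟨σ, hσ⟩ := IsCyclic.exists_generator (α := L ≃ₐ[K] L)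
  obtain ⟨ϖ, hϖ⟩ := hw (WithZero.exp (-1))
  obtain ⟨b, hb⟩ := exists_isDepthSeq hv hram hdeg hϖ hσ
  have hlower : ∀ i < n, lowerBreak K w (i + 1) = b i :=
    fun i hi => lowerBreak_eq hv hram hdeg hϖ hσ hb hi
  -- Index all vectors by natural numbers.
  set X : ℕ → L := x.out.coeff with hXdef
  have hX : ∀ j : Fin n, X j = x.coeff j := fun j => TruncatedWittVector.coeff_out x j
  set β' := wittMap (algebraMap K L) β with hβ'
  set D : ℕ → L := fun j => (x.out + β'.out).coeff j - x.out.coeff j - β'.out.coeff j with hD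
  set Ω : ℕ → K := fun j => if h : j < n then ω ⟨j, h⟩ else 0 with hΩdef
  set Δ : ℕ → K := fun j => if h : j < n then δ ⟨j, h⟩ else 0 with hΔdef
  have hΩ : ∀ j : Fin n, Ω j = ω j := fun j => by simp [hΩdef]
  have hΔ : ∀ j : Fin n, Δ j = δ j := fun j => by simp [hΔdef]
  have hβout : ∀ j : Fin n, β'.out.coeff j = algebraMap K L (β.coeff j) := fun j => by
    rw [TruncatedWittVector.coeff_out, hβ', coeff_wittMap]
  set m' : ℕ → ℤ := fun j => WithZero.log (v (Ω j)) with hm'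
  set B : ℕ → ℤ := fun j => WithZero.log (v (β.coeff 0)) + (p : ℤ) ^ (n - 1) * m' j with hB
  have hβ0 : v (β.coeff 0) ≠ 0 := ((zero_le).trans_lt (hδ 0)).ne'
  have hmain : ∀ j : Fin n, v (β.coeff 0 * ω j ^ p ^ (n - 1)) = v (β.coeff j) := by
    intro j
    have h1 : β.coeff 0 * ω j ^ p ^ (n - 1) = β.coeff j - δ j := by rw [hβ j]; ring
    rw [h1, Valuation.map_sub_eq_of_lt_left v (hδ j)]
  have hωne : ∀ j : Fin n, v (ω j) ≠ 0 := by
    intro j h0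
    have h1 := hmain j
    rw [map_mul, map_pow, h0, zero_pow (pow_ne_zero _ hp.ne_zero), mul_zero] at h1
    exact absurd (hδ j) (by rw [← h1]; exact not_lt.2 zero_le)
  have hm'0 : m' 0 = 0 := by
    have h1 : Ω 0 = 1 := by
      have := hΩ 0
      rw [hω0, Fin.val_zero] at this
      exact this
    simp only [hm']
    rw [h1, map_one, WithZero.log_one]
  have hB0 : B 0 = WithZero.log (v (β.coeff 0)) := by
    simp only [hB]
    rw [hm'0, mul_zero, add_zero]
  have hβB : ∀ j : Fin n, v (β.coeff j) = WithZero.exp (B j) := by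
    intro j
    have h1 : WithZero.log (v (ω j)) = m' j := by simp only [hm']; rw [hΩ j]
    rw [← hmain j, map_mul, map_pow, ← WithZero.exp_log hβ0, ← WithZero.exp_log (hωne j), exp_pow,
      ← WithZero.exp_add, h1]
    simp only [hB]
    push_cast
    rfl
  have hC : IsCoordinateSystem p n v X D (β.coeff 0) Ω Δ m' B := by
    refine ⟨fun j hj => ?_, fun j hj => ?_, hm'0, fun j => ?_, ?_⟩
    · have h1 := congrArg (fun z => z.coeff ⟨j, hj⟩) hx.1
      simp only [coeff_wittMap, truncated_coeff_add] at h1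
      have h2 : X j = x.coeff ⟨j, hj⟩ := hX ⟨j, hj⟩
      have h3 : β'.out.coeff j = algebraMap K L (β.coeff ⟨j, hj⟩) := hβout ⟨j, hj⟩
      have h4 : Ω j = ω ⟨j, hj⟩ := hΩ ⟨j, hj⟩
      have h5 : Δ j = δ ⟨j, hj⟩ := hΔ ⟨j, hj⟩
      rw [← h2] at h1
      rw [h1, h4, h5, ← add_assoc (algebraMap K L _), ← map_add, ← hβ ⟨j, hj⟩, ← h3]
      simp only [hD, hXdef]
      ring
    · have h4 : Ω j = ω ⟨j, hj⟩ := hΩ ⟨j, hj⟩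
      simp only [hm']
      rw [h4, WithZero.exp_log (hωne _)]
    · rw [hB0]
    · rw [hB0, WithZero.exp_log hβ0]
  obtain ⟨c, hc, hc0, hfix, hmove⟩ := exists_galois_action hdeg hx σ hσ
  have hrows : ∀ i < n, RowBounds p n w X D Δ B b i ∧ ¬ (p : ℤ) ∣ B 0 := by
    intro i hi
    refine rowBounds hv hram hdeg hϖ hσ hb hC ?_ hc hc0 (fun i hi j hj => ?_) (fun i hi => ?_) ?_ ?_
      (fun j hj s hs => ?_) (fun j hj => ?_) (fun i hi => ?_) (fun i h1 hi hne => ?_) hi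
    · refine (hred 0).imp (fun h => ?_) (fun h => ?_)
      · rwa [hB0, ← WithZero.exp_le_exp, WithZero.exp_log hβ0, WithZero.exp_zero]
      · rwa [ord, dvd_neg, ← hB0] at h
    · have := hfix i hi ⟨j, by omega⟩ hj
      rwa [← hX ⟨j, by omega⟩] at this
    · have := hmove ⟨i, hi⟩
      rwa [← hX ⟨i, hi⟩] at this
    · simp only [hD]
      rw [WittVector.add_coeff_zero]
      ring
    · have := hΔ 0
      rwa [hδ0, Fin.val_zero] at this
    · refine valuation_cross_term_le_exp hw _ _ j s (fun l hl => (hs l hl).1) fun l hl => ?_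
      have h1 : β'.out.coeff l = algebraMap K L (β.coeff ⟨l, by omega⟩) := hβout ⟨l, by omega⟩
      rw [h1, hw', hβB, exp_pow, WithZero.exp_le_exp]
      push_cast
      exact (hs l hl).2
    · have h5 : Δ j = δ ⟨j, hj⟩ := hΔ ⟨j, hj⟩
      rw [h5]
      exact (hδ ⟨j, hj⟩).trans_eq (hβB ⟨j, hj⟩)
    · have := hbreak (i + 1) (by omega) (by omega)
      rwa [hlower (i + 1) hi] at this
    · have h5 : Δ i = δ ⟨i, hi⟩ := hΔ ⟨i, hi⟩
      rw [h5] at hne ⊢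
      have := herror ⟨i, hi⟩ h1 hne
      simp only at this
      rwa [hlower i hi, ord, neg_mul_neg] at this
  have hb0 : lowerBreak K w 1 = b 0 := hlower 0 hn
  have hB0b : (b 0 : ℤ) = B 0 := by
    have := (hrows 0 hn).1.depth
    simpa [lowerOfUpper] using this.symm
  have hpB := (hrows 0 hn).2
  clear_value X D Ω Δ m' B
  obtain ⟨r, rfl⟩ : ∃ r, n = r + 1 := ⟨n - 1, by omega⟩
  have hval := valuation_detCol_of_rowBounds hw' hC (fun i hi => hb.one_le i hi)
    fun i hi => (hrows i hi).1
  rw [← elementY_eq_detCol ω x hΩ hX] at hval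
  refine ⟨adjoin_eq_top_of_not_dvd hram hdeg hval ?_, ?_, ?_⟩
  · rw [dvd_add_left (Finset.dvd_sum fun k _ => ?_)]
    · exact hpB
    · exact Dvd.dvd.mul_right (dvd_pow_self _ (by omega)) _
  · exact (Valuation.ne_zero_iff w).1 (by rw [hval]; exact WithZero.exp_ne_zero)
  · have hmm : ∀ k : Fin r, m k.succ = m' (k + 1) := by
      intro k
      rw [hm, ord, neg_neg, hm', ← hΩ, Fin.val_succ]
    have hsum : ∑ i ∈ Finset.univ.filter (fun i : Fin (r + 1) => 1 ≤ (i : ℕ)),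
        (p : ℤ) ^ (r + 1 - 1 + (i : ℕ)) * m i =
          ∑ k : Fin r, (p : ℤ) ^ (r + 1 + (k : ℕ)) * m' (k + 1) := by
      rw [Finset.sum_filter, Fin.sum_univ_succ, if_neg (by simp), zero_add]
      refine Finset.sum_congr rfl fun k _ => ?_
      rw [if_pos (by simp), hmm, Fin.val_succ]
      congr 2
      omega
    rw [ord, hval, WithZero.log_exp, hb0, hB0b, hsum]
    ring
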